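/- A symmetric categorical group is a small symmetric monoidal groupoid in which every object is invertible up to isomorphism with respect to the tensor product. Symmetric categorical groups form a 2-category, whose morphisms are the symmetric (strong) monoidal functors and whose 2-morphisms, called tracks, are the monoidal natural transformations (which are all invertible). For a symmetric categorical group $\mathbb{S}$ let $\pi_0(\mathbb{S})$ be the abelian group of connected components of $\mathbb{S}$, let $\pi_1(\mathbb{S})$ be the abelian group of automorphisms of the neutral object, and let $k_{\mathbb{S}}:\pi_0(\mathbb{S})/2\pi_0(\mathbb{S})\to\pi_1(\mathbb{S})$ be the homomorphism induced by the commutativity constraints $X\otimes X\to X\otimes X$. Put $\mathrm{type}(\mathbb{S})=(\pi_0(\mathbb{S}),\pi_1(\mathbb{S}),k_{\mathbb{S}})$; it is an object of the category of types, whose objects are the triples $(A_0,A_1,\alpha)$ with $A_0,A_1$ abelian groups and $\alpha\in\mathrm{Hom}(A_0/2A_0,A_1)$, and whose morphisms $(A_0,A_1,\alpha)\to(B_0,B_1,\beta)$ are the pairs of homomorphisms $f_i:A_i\to B_i$ with $\beta f_0=f_1\alpha$. For an abelian group $M$ with $2$-torsion subgroup ${}_2M=\{m\in M\mid 2m=0\}$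 put $l(M)=(M,M/2M,\mathrm{id}_{M/2M})$ and $r(M)=({}_2M,M,\mathrm{id}_{{}_2M})$, where $\mathrm{Hom}({}_2M/2({}_2M),M)$ is identified with $\mathrm{Hom}({}_2M,{}_2M)$. A morphism of symmetric categorical groups is called essentially surjective if it is surjective on $\pi_0$, and faithful if it is injective on $\pi_1$. A symmetric categorical group $\mathbb{P}$ is called projective if for every essentially surjective $F:\mathbb{S}_1\to\mathbb{S}_2$ and every $G:\mathbb{P}\to\mathbb{S}_2$ there are a morphism $L:\mathbb{P}\to\mathbb{S}_1$ and a track from $FL$ to $G$; $\mathbb{Q}$ is called injective if for every faithful $F:\mathbb{S}_1\to\mathbb{S}_2$ and every $G:\mathbb{S}_1\to\mathbb{Q}$ there are a morphism $L:\mathbb{S}_2\to\mathbb{Q}$ and a track from $LF$ to $G$. **Proposition 2.** The 2-category of symmetric categorical groups has enough projective and enough injective objects: for every symmetric categorical group $\mathbb{S}$ there are an essentially surjective morphism $\mathbb{P}\to\mathbb{S}$ with $\mathbb{P}$ projective and a faithful morphism $\mathbb{S}\to\mathbb{Q}$ with $\mathbb{Q}$ injective. More precisely, for every symmetric categorical group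 $\mathbb{S}$: 1. there is a free abelian group $P$ such that symmetric categorical groups $\mathbb{T}$ with $\mathrm{type}(\mathbb{T})\cong l(P)$ exist, and every such $\mathbb{T}$ is projective and admits an essentially surjective morphism $\mathbb{T}\to\mathbb{S}$; 2. there is a divisible abelian group $Q$ such that symmetric categorical groups $\mathbb{T}$ with $\mathrm{type}(\mathbb{T})\cong r(Q)$ exist, and every such $\mathbb{T}$ is injective and admits a faithful morphism $\mathbb{S}\to\mathbb{T}$. -/

import Mathlib

open CategoryTheory MonoidalCategory

universe u

/-- A (small) symmetric categorical group: a symmetric monoidal groupoid in which every object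
is invertible, up to isomorphism, for the tensor product. -/
structure SymCatGr : Type (u + 1) where
  carrier : Type u
  [category : SmallCategory carrier]
  [isGroupoid : IsGroupoid carrier]
  [monoidal : MonoidalCategory carrier]
  [symmetric : SymmetricCategory carrier]
  exists_inverse : ∀ X : carrier, ∃ Y : carrier, Nonempty (X ⊗ Y ≅ 𝟙_ carrier)

namespace SymCatGr

attribute [instance] category isGroupoid monoidal symmetric

/-! ### The 2-category of symmetric categorical groups -/

/-- A morphism of symmetric categorical groups: a (strong) monoidal functor compatible with the
commutativity constraints. -/
structure Morphism (S T : SymCatGr.{u}) : Type u where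
  functor : S.carrier ⥤ T.carrier
  [braided : functor.Braided]

attribute [instance] Morphism.braided

/-- A track (2-morphism) between morphisms of symmetric categorical groups: a monoidal natural
transformation. It is automatically invertible, since the target is a groupoid. -/
@[ext]
structure Track {S T : SymCatGr.{u}} (F G : Morphism S T) : Type u where
  natTrans : F.functor ⟶ G.functor
  [isMonoidal : NatTrans.IsMonoidal natTrans]

attribute [instance] Track.isMonoidal

/-- Tracks form the arrows of a category, with vertical composition. -/
instance (S T : SymCatGr.{u}) : Category (Morphism S T) where
  Hom := Track
  id F := ⟨𝟙 F.functor⟩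
  comp a b := ⟨a.natTrans ≫ b.natTrans⟩
  id_comp _ := Track.ext (Category.id_comp _)
  comp_id _ := Track.ext (Category.comp_id _)
  assoc _ _ _ := Track.ext (Category.assoc _ _ _)

/-- A monoidal natural isomorphism is an isomorphism for the vertical composition of tracks. -/
def trackIso {S T : SymCatGr.{u}} {F G : Morphism S T} (e : F.functor ≅ G.functor)
    [NatTrans.IsMonoidal e.hom] : F ≅ G where
  hom := (⟨e.hom⟩ : Track F G)
  inv := (⟨e.inv⟩ : Track G F)
  hom_inv_id := Track.ext e.hom_inv_id
  inv_hom_id := Track.ext e.inv_hom_id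

instance : CategoryStruct SymCatGr.{u} where
  Hom := Morphism
  id S := ⟨𝟭 S.carrier⟩
  comp F G := ⟨F.functor ⋙ G.functor⟩

/-- The 2-category of symmetric categorical groups. -/
instance : Bicategory SymCatGr.{u} where
  homCategory S T := inferInstanceAs (Category (Morphism S T))
  whiskerLeft F _ _ t := (⟨Functor.whiskerLeft (Morphism.functor F) (Track.natTrans t)⟩ : Track _ _)
  whiskerRight t H := (⟨Functor.whiskerRight (Track.natTrans t) (Morphism.functor H)⟩ : Track _ _)
  associator F G H :=
    trackIso (Functor.associator (Morphism.functor F) (Morphism.functor G) (Morphism.functor H))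
  leftUnitor F := trackIso (Functor.leftUnitor (Morphism.functor F))
  rightUnitor F := trackIso (Functor.rightUnitor (Morphism.functor F))
  whiskerLeft_id _ _ := Track.ext (by ext; rfl)
  whiskerLeft_comp _ _ _ _ _ _ := Track.ext (by ext; rfl)
  id_whiskerLeft _ :=
    Track.ext (by ext; exact ((Category.id_comp _).trans (Category.comp_id _)).symm)
  comp_whiskerLeft _ _ _ _ _ :=
    Track.ext (by ext; exact ((Category.id_comp _).trans (Category.comp_id _)).symm)
  id_whiskerRight _ G := Track.ext (by ext X; exact (Morphism.functor G).map_id _)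
  comp_whiskerRight _ _ H := Track.ext (by ext X; exact (Morphism.functor H).map_comp _ _)
  whiskerRight_id _ :=
    Track.ext (by ext; exact ((Category.id_comp _).trans (Category.comp_id _)).symm)
  whiskerRight_comp _ _ _ :=
    Track.ext (by ext; exact ((Category.id_comp _).trans (Category.comp_id _)).symm)
  whisker_assoc _ _ _ _ _ :=
    Track.ext (by ext; exact ((Category.id_comp _).trans (Category.comp_id _)).symm)
  whisker_exchange s t :=
    Track.ext (by ext X; exact ((Track.natTrans t).naturality ((Track.natTrans s).app X)).symm)
  pentagon F G H K := Track.ext (by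
    ext X
    refine Eq.trans (b := 𝟙 _ ≫ 𝟙 _ ≫ 𝟙 _) ?_ (Category.id_comp _)
    exact congrArg (fun f => f ≫ 𝟙 _ ≫ 𝟙 _) ((Morphism.functor K).map_id
      ((Morphism.functor H).obj ((Morphism.functor G).obj ((Morphism.functor F).obj X)))))
  triangle F G := Track.ext (by
    ext X
    exact (Category.id_comp _).trans ((Morphism.functor G).map_id _).symm)

/-- A morphism of `SymCatGr`, as a functor between the underlying groupoids. -/
abbrev fn {S T : SymCatGr.{u}} (F : S ⟶ T) : S.carrier ⥤ T.carrier := Morphism.functor F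

instance {S T : SymCatGr.{u}} (F : S ⟶ T) : (fn F).Braided := Morphism.braided F

/-! ### The group `π₀` -/

/-- `π₀(S)`: the set of connected components of `S`, made a group by the tensor product below. -/
def Pi0 (S : SymCatGr.{u}) : Type u := CategoryTheory.ConnectedComponents S.carrier

/-- The class of an object in `π₀`. -/
def Pi0.mk {S : SymCatGr.{u}} (X : S.carrier) : Pi0 S := Quotient.mk _ X

theorem nonempty_iso_of_zigzag {S : SymCatGr.{u}} {X Y : S.carrier} (h : Zigzag X Y) :
    Nonempty (X ≅ Y) := by
  induction h with
  | refl => exact ⟨Iso.refl _⟩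
  | tail _ h ih =>
    obtain ⟨e⟩ := ih
    rcases h with ⟨⟨f⟩⟩ | ⟨⟨f⟩⟩
    · exact ⟨e ≪≫ asIso f⟩
    · exact ⟨e ≪≫ (asIso f).symm⟩

theorem Pi0.mk_eq_iff {S : SymCatGr.{u}} {X Y : S.carrier} :
    Pi0.mk X = Pi0.mk Y ↔ Nonempty (X ≅ Y) :=
  ⟨fun h => nonempty_iso_of_zigzag (Quotient.exact h),
    fun ⟨e⟩ => Quotient.sound (Zigzag.of_hom e.hom)⟩

theorem Pi0.ind {S : SymCatGr.{u}} {p : Pi0 S → Prop} (h : ∀ X, p (Pi0.mk X)) (x : Pi0 S) : p x :=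
  Quotient.ind h x

/-- Functions out of `π₀` are functions on objects that are invariant under isomorphism. -/
def Pi0.lift {S : SymCatGr.{u}} {A : Type*} (f : S.carrier → A)
    (hf : ∀ X Y : S.carrier, (X ≅ Y) → f X = f Y) (x : Pi0 S) : A :=
  Quotient.lift f (fun X Y h => (nonempty_iso_of_zigzag h).elim (hf X Y)) x

/-- The addition of `π₀(S)` is induced by the tensor product: `[X] + [Y] = [X ⊗ Y]`. -/
instance (S : SymCatGr.{u}) : Add (Pi0 S) where
  add := Pi0.lift (fun X => Pi0.lift (fun Y => Pi0.mk (X ⊗ Y))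
      fun _ _ e => Pi0.mk_eq_iff.2 ⟨whiskerLeftIso X e⟩)
    fun _ _ e => funext (Pi0.ind fun Z => Pi0.mk_eq_iff.2 ⟨whiskerRightIso e Z⟩)

instance (S : SymCatGr.{u}) : Zero (Pi0 S) := ⟨Pi0.mk (𝟙_ S.carrier)⟩

theorem Pi0.exists_neg {S : SymCatGr.{u}} (x : Pi0 S) : ∃ y : Pi0 S, y + x = 0 := by
  induction x using Pi0.ind with | h X => ?_
  obtain ⟨Y, ⟨e⟩⟩ := S.exists_inverse X
  exact ⟨Pi0.mk Y, Pi0.mk_eq_iff.2 ⟨β_ Y X ≪≫ e⟩⟩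

/-- The inverse of `[X]` is the class of any tensor inverse of `X`. -/
noncomputable instance (S : SymCatGr.{u}) : Neg (Pi0 S) := ⟨fun x => (Pi0.exists_neg x).choose⟩

noncomputable instance (S : SymCatGr.{u}) : AddCommGroup (Pi0 S) where
  add_assoc x y z := by
    induction x using Pi0.ind with | h X => ?_
    induction y using Pi0.ind with | h Y => ?_
    induction z using Pi0.ind with | h Z => ?_
    exact Pi0.mk_eq_iff.2 ⟨α_ X Y Z⟩
  zero_add x := by
    induction x using Pi0.ind with | h X => ?_
    exact Pi0.mk_eq_iff.2 ⟨λ_ X⟩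
  add_zero x := by
    induction x using Pi0.ind with | h X => ?_
    exact Pi0.mk_eq_iff.2 ⟨ρ_ X⟩
  neg_add_cancel x := (Pi0.exists_neg x).choose_spec
  add_comm x y := by
    induction x using Pi0.ind with | h X => ?_
    induction y using Pi0.ind with | h Y => ?_
    exact Pi0.mk_eq_iff.2 ⟨β_ X Y⟩
  nsmul := nsmulRec
  zsmul := zsmulRec

/-- The homomorphism `π₀(F)`, given by `[X] ↦ [F X]`. -/
def pi0Map {S T : SymCatGr.{u}} (F : S ⟶ T) : Pi0 S →+ Pi0 T where
  toFun := Pi0.lift (fun X => Pi0.mk ((fn F).obj X))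
    fun _ _ e => Pi0.mk_eq_iff.2 ⟨(fn F).mapIso e⟩
  map_zero' := Pi0.mk_eq_iff.2 ⟨(Functor.Monoidal.εIso (fn F)).symm⟩
  map_add' x y := by
    induction x using Pi0.ind with | h X => ?_
    induction y using Pi0.ind with | h Y => ?_
    exact Pi0.mk_eq_iff.2 ⟨(Functor.Monoidal.μIso (fn F) X Y).symm⟩

/-! ### The group `π₁` -/

/-- The automorphism of `X` induced by an automorphism `a` of the neutral object:
`X ≅ 𝟙 ⊗ X ≅ 𝟙 ⊗ X ≅ X`, the middle arrow being `a ⊗ X`. -/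
def act {S : SymCatGr.{u}} (a : Aut (𝟙_ S.carrier)) (X : S.carrier) : X ≅ X :=
  (λ_ X).symm ≪≫ whiskerRightIso a X ≪≫ λ_ X

theorem act_hom {S : SymCatGr.{u}} (a : Aut (𝟙_ S.carrier)) (X : S.carrier) :
    (act a X).hom = (λ_ X).inv ≫ a.hom ▷ X ≫ (λ_ X).hom := rfl

theorem act_unit {S : SymCatGr.{u}} (a : Aut (𝟙_ S.carrier)) :
    (act a (𝟙_ S.carrier)).hom = a.hom := by
  rw [act_hom, MonoidalCategory.whiskerRight_id, unitors_equal, unitors_inv_equal]; simp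

theorem act_naturality {S : SymCatGr.{u}} (a : Aut (𝟙_ S.carrier)) {X Y : S.carrier}
    (f : X ⟶ Y) : (act a X).hom ≫ f = f ≫ (act a Y).hom := by
  rw [act_hom, act_hom, Category.assoc, Category.assoc, ← leftUnitor_naturality,
    ← whisker_exchange_assoc, leftUnitor_inv_naturality_assoc]

theorem act_mul {S : SymCatGr.{u}} (a b : Aut (𝟙_ S.carrier)) (X : S.carrier) :
    (act (a * b) X).hom = (act b X).hom ≫ (act a X).hom := by
  rw [act_hom, act_hom, act_hom]
  change _ ≫ (b.hom ≫ a.hom) ▷ X ≫ _ = _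
  simp

/-- `π₁(S)`: the group of automorphisms of the neutral object, written additively. -/
def Pi1 (S : SymCatGr.{u}) : Type u := Additive (Aut (𝟙_ S.carrier))

instance (S : SymCatGr.{u}) : AddCommGroup (Pi1 S) where
  __ := (inferInstance : AddGroup (Additive (Aut (𝟙_ S.carrier))))
  add_comm a b := by
    have h : ∀ a b : Aut (𝟙_ S.carrier), a * b = b * a := fun a b => Iso.ext (by
      have := act_naturality a b.hom
      rw [act_unit] at this
      exact this.symm)
    exact h a b

/-- The element of `π₁` given by an automorphism of the neutral object. -/
def Pi1.mk {S : SymCatGr.{u}} (a : Aut (𝟙_ S.carrier)) : Pi1 S := Additive.ofMul a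

/-- The automorphism of the neutral object given by an element of `π₁`. -/
def Pi1.toAut {S : SymCatGr.{u}} (a : Pi1 S) : Aut (𝟙_ S.carrier) := Additive.toMul a

/-- The homomorphism `π₁(F)`: it sends `a : 𝟙 ≅ 𝟙` to `𝟙 ≅ F 𝟙 ≅ F 𝟙 ≅ 𝟙`, the middle arrow being
`F a` and the outer ones the unit constraint of `F`. -/
def pi1Map {S T : SymCatGr.{u}} (F : S ⟶ T) : Pi1 S →+ Pi1 T where
  toFun a := Pi1.mk (Functor.Monoidal.εIso (fn F) ≪≫ (fn F).mapIso a.toAut ≪≫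
    (Functor.Monoidal.εIso (fn F)).symm)
  map_zero' := Iso.ext (by
    change _ ≫ (fn F).map (𝟙 _) ≫ _ = 𝟙 _
    simp)
  map_add' a b := Iso.ext (by
    change _ ≫ (fn F).map (b.toAut.hom ≫ a.toAut.hom) ≫ _ =
      (_ ≫ (fn F).map b.toAut.hom ≫ _) ≫ (_ ≫ (fn F).map a.toAut.hom ≫ _)
    simp)

/-! ### The invariant `k` -/

theorem act_whiskerRight {S : SymCatGr.{u}} (a : Aut (𝟙_ S.carrier)) (X Y : S.carrier) :
    (act a X).hom ▷ Y = (act a (X ⊗ Y)).hom := by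
  simp [act_hom]

theorem act_whiskerLeft {S : SymCatGr.{u}} (a : Aut (𝟙_ S.carrier)) (X Y : S.carrier) :
    X ◁ (act a Y).hom = (act a (X ⊗ Y)).hom := by
  rw [← cancel_mono (β_ X Y).hom, BraidedCategory.braiding_naturality_right, act_whiskerRight,
    act_naturality]

theorem tensorRight_isEquivalence (S : SymCatGr.{u}) (X : S.carrier) :
    (tensorRight X).IsEquivalence := by
  obtain ⟨Y, ⟨e⟩⟩ := S.exists_inverse X
  have h : ∀ U V : S.carrier, (U ⊗ V ≅ 𝟙_ S.carrier) →
      Nonempty (tensorRight U ⋙ tensorRight V ≅ 𝟭 S.carrier) := fun U V e =>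
    ⟨(tensorRightTensor U V).symm ≪≫ (tensoringRight S.carrier).mapIso e ≪≫
      rightUnitorNatIso S.carrier⟩
  obtain ⟨i⟩ := h X Y e
  obtain ⟨j⟩ := h Y X (β_ Y X ≪≫ e)
  exact (CategoryTheory.Equivalence.mk (tensorRight X) (tensorRight Y)
    i.symm j).isEquivalence_functor

theorem act_bijective {S : SymCatGr.{u}} (X : S.carrier) :
    Function.Bijective (fun a : Aut (𝟙_ S.carrier) => act a X) := by
  have := tensorRight_isEquivalence S X
  constructor
  · intro a b h
    have h' : (act a X).hom = (act b X).hom := congrArg Iso.hom h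
    refine Iso.ext ((tensorRight X).map_injective ?_)
    simpa [act_hom] using h'
  · intro f
    refine ⟨(tensorRight X).preimageIso (λ_ X ≪≫ f ≪≫ (λ_ X).symm), Iso.ext ?_⟩
    have : ((tensorRight X).preimageIso (λ_ X ≪≫ f ≪≫ (λ_ X).symm)).hom ▷ X =
        (λ_ X ≪≫ f ≪≫ (λ_ X).symm).hom := (tensorRight X).map_preimage _
    change (λ_ X).inv ≫ ((tensorRight X).preimageIso _).hom ▷ X ≫ (λ_ X).hom = _
    rw [this]
    simp

/-- The automorphism of the neutral object that induces the commutativity constraint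
`X ⊗ X ≅ X ⊗ X`. -/
noncomputable def selfBraiding {S : SymCatGr.{u}} (X : S.carrier) : Aut (𝟙_ S.carrier) :=
  ((act_bijective (X ⊗ X)).2 (β_ X X)).choose

theorem act_selfBraiding {S : SymCatGr.{u}} (X : S.carrier) :
    act (selfBraiding X) (X ⊗ X) = β_ X X :=
  ((act_bijective (X ⊗ X)).2 (β_ X X)).choose_spec

theorem eq_of_act_hom {S : SymCatGr.{u}} {a b : Aut (𝟙_ S.carrier)} (X : S.carrier)
    (h : (act a X).hom = (act b X).hom) : a = b :=
  (act_bijective X).1 (Iso.ext h)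

theorem selfBraiding_congr {S : SymCatGr.{u}} {X Y : S.carrier} (e : X ≅ Y) :
    selfBraiding X = selfBraiding Y := by
  apply eq_of_act_hom (Y ⊗ Y)
  rw [← cancel_epi (e.hom ⊗ₘ e.hom), ← act_naturality, act_selfBraiding, act_selfBraiding,
    BraidedCategory.braiding_naturality]

theorem selfBraiding_tensor {S : SymCatGr.{u}} (X Y : S.carrier) :
    selfBraiding (X ⊗ Y) = selfBraiding Y * selfBraiding X := by
  apply eq_of_act_hom ((X ⊗ Y) ⊗ (X ⊗ Y))
  rw [act_selfBraiding, ← cancel_epi (tensorμ X X Y Y), SymmetricCategory.tensorμ_braid_swap,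
    ← act_naturality, act_mul, MonoidalCategory.tensorHom_def, ← act_selfBraiding X,
    ← act_selfBraiding Y, act_whiskerRight, act_whiskerLeft]

theorem selfBraiding_mul_self {S : SymCatGr.{u}} (X : S.carrier) :
    selfBraiding X * selfBraiding X = 1 := by
  apply eq_of_act_hom (X ⊗ X)
  rw [act_mul, act_selfBraiding, SymmetricCategory.symmetry]
  change _ = (λ_ _).inv ≫ (𝟙 _) ▷ _ ≫ (λ_ _).hom
  simp

/-- The homomorphism `k : π₀(S) → π₁(S)` induced by the commutativity constraints `X ⊗ X ≅ X ⊗ X`,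
where `π₁(S)` is identified with the automorphism group of any object of `S` through `act`. -/
noncomputable def kInv (S : SymCatGr.{u}) : Pi0 S →+ Pi1 S :=
  AddMonoidHom.mk' (Pi0.lift (fun X => Pi1.mk (selfBraiding X))
    fun _ _ e => congrArg Pi1.mk (selfBraiding_congr e)) fun x y => by
      induction x using Pi0.ind with | h X => ?_
      induction y using Pi0.ind with | h Y => ?_
      exact (congrArg Pi1.mk (selfBraiding_tensor X Y)).trans
        (add_comm (Pi1.mk (selfBraiding Y)) (Pi1.mk (selfBraiding X)))

theorem two_nsmul_kInv (S : SymCatGr.{u}) (x : Pi0 S) : 2 • kInv S x = 0 := by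
  rw [two_nsmul]
  induction x using Pi0.ind with | h X => ?_
  exact selfBraiding_mul_self X

end SymCatGr

/-! ### The category of types -/

/-- An object `(A₀, A₁, α)` of the category of types: abelian groups `A₀`, `A₁` and an element
`α ∈ Hom(A₀ / 2 A₀, A₁) = Hom(A₀, ₂A₁)`, that is, a homomorphism `α : A₀ → A₁` with `2 α = 0`. -/
structure GrType : Type (u + 1) where
  zero : Type u
  one : Type u
  [addCommGroupZero : AddCommGroup zero]
  [addCommGroupOne : AddCommGroup one]
  k : zero →+ one
  two_nsmul_k : ∀ x, 2 • k x = 0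

namespace GrType

attribute [instance] addCommGroupZero addCommGroupOne

/-- A morphism of types: a pair of homomorphisms `f₀ : A₀ → B₀` and `f₁ : A₁ → B₁` such that
`β f₀ = f₁ α`. -/
@[ext]
structure Hom (A B : GrType.{u}) : Type u where
  zero : A.zero →+ B.zero
  one : A.one →+ B.one
  comm : B.k.comp zero = one.comp A.k

/-- The category of types. -/
instance : Category GrType.{u} where
  Hom := Hom
  id A := ⟨AddMonoidHom.id _, AddMonoidHom.id _, rfl⟩
  comp f g := ⟨g.zero.comp f.zero, g.one.comp f.one, by
    rw [← AddMonoidHom.comp_assoc, g.comm, AddMonoidHom.comp_assoc, f.comm,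
      AddMonoidHom.comp_assoc]⟩

/-- The subgroup `2 M` of an abelian group `M`. -/
def twoMul (M : Type u) [AddCommGroup M] : AddSubgroup M := (nsmulAddMonoidHom (α := M) 2).range

/-- The subgroup `₂M` of the elements `m` of an abelian group `M` such that `2 m = 0`. -/
def twoTorsion (M : Type u) [AddCommGroup M] : AddSubgroup M := (nsmulAddMonoidHom (α := M) 2).ker

/-- The type `l(M) = (M, M / 2 M, id)`, that is, with the quotient map `M → M / 2 M` as
its homomorphism. -/
def l (M : Type u) [AddCommGroup M] : GrType.{u} where
  zero := M
  one := M ⧸ twoMul M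
  k := QuotientAddGroup.mk' (twoMul M)
  two_nsmul_k x := by
    rw [← map_nsmul]
    exact (QuotientAddGroup.eq_zero_iff _).2 ⟨x, rfl⟩

/-- The type `r(M) = (₂M, M, id)`, that is, with the inclusion `₂M → M` as its homomorphism. -/
def r (M : Type u) [AddCommGroup M] : GrType.{u} where
  zero := twoTorsion M
  one := M
  k := (twoTorsion M).subtype
  two_nsmul_k x := x.2

end GrType

namespace SymCatGr

/-- `type(S) = (π₀(S), π₁(S), k)`. -/
noncomputable def type (S : SymCatGr.{u}) : GrType.{u} where
  zero := Pi0 S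
  one := Pi1 S
  k := kInv S
  two_nsmul_k := two_nsmul_kInv S

/-! ### Projective and injective objects -/

/-- A morphism of symmetric categorical groups is essentially surjective if it is onto on `π₀`. -/
def IsEssSurj {S T : SymCatGr.{u}} (F : S ⟶ T) : Prop := Function.Surjective (pi0Map F)

/-- A morphism of symmetric categorical groups is faithful if it is injective on `π₁`. -/
def IsFaithful {S T : SymCatGr.{u}} (F : S ⟶ T) : Prop := Function.Injective (pi1Map F)

/-- `P` is projective if every morphism `G : P ⟶ S₂` lifts, up to a track, along every essentially
surjective morphism `F : S₁ ⟶ S₂`. -/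
def IsProjective (P : SymCatGr.{u}) : Prop :=
  ∀ ⦃S₁ S₂ : SymCatGr.{u}⦄ (F : S₁ ⟶ S₂), IsEssSurj F → ∀ G : P ⟶ S₂,
    ∃ L : P ⟶ S₁, Nonempty (L ≫ F ≅ G)

/-- `Q` is injective if every morphism `G : S₁ ⟶ Q` extends, up to a track, along every faithful
morphism `F : S₁ ⟶ S₂`. -/
def IsInjective (Q : SymCatGr.{u}) : Prop :=
  ∀ ⦃S₁ S₂ : SymCatGr.{u}⦄ (F : S₁ ⟶ S₂), IsFaithful F → ∀ G : S₁ ⟶ Q,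
    ∃ L : S₂ ⟶ Q, Nonempty (F ≫ L ≅ G)

end SymCatGr

/-!
A symmetric categorical group `S` is determined by `π₀(S)`, `π₁(S)` and a symmetric 3-cocycle on
`π₀(S)` with values in `π₁(S)`, formed by the constraints of associativity and commutativity
(`SymCatGr.DegreeFunction.cocycle`); the diagonal of the commutativity part is the invariant `k`. A
pair of homomorphisms `f₀ : π₀(S) → π₀(T)` and `f₁ : π₁(S) → π₁(T)` is realized by a morphism
`S ⟶ T` exactly when the difference of the two cocycles, on `π₀(S)` with values in `π₁(T)`, is a
coboundary, and two morphisms that realize the same pair differ by a symmetric 2-cocycle, that is,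
by an extension of `π₀(S)` by `π₁(T)`.

If `f₀` and `f₁` are compatible with `k`, the difference cocycle vanishes on the diagonal, and such
cocycles are coboundaries if `π₀(S)` is free (`SymCocycle.trivializable_of_free`) or `π₁(T)` is
divisible (`SymCocycle.trivializable_of_isDivisible`). For the integers this is a direct
computation. For a direct sum a trivialization is given by the interchange isomorphism
`(x₁ x₂) (y₁ y₂) ≅ (x₁ y₁) (x₂ y₂)`, and Zorn's lemma gives the free abelian groups. For divisible
coefficients the trivialization on a free abelian group that maps onto `π₀(S)` is corrected so as to
descend. Under the same hypotheses the extensions split. Hence, if `π₀(S)` is free or `π₁(T)` is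
divisible, every morphism of types is realized by a morphism `S ⟶ T` (`SymCatGr.exists_morphism`),
unique up to a track (`SymCatGr.nonempty_iso_of_pi_eq`).

If `type(T) ≅ l(P)` with `P` free, then a morphism of types out of `type(T)` is the same as a
homomorphism out of `P`, so that projectivity of `T` reduces to projectivity of `P`; the free
abelian group on the set `π₀(S)` gives the essentially surjective morphism to `S`. Dually, if
`type(T) ≅ r(Q)` with `Q` divisible, then a morphism of types into `type(T)` is the same as a
homomorphism into `Q`, and injectivity of `T` reduces to that of `Q`; an embedding of `π₁(S)` in a
divisible group gives the faithful morphism from `S`. Both types are realized by strictly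
associative skeletal models with a biadditive braiding.
-/

/-! ### Symmetric 3-cocycles and skeletal symmetric categorical groups -/

/-- A normalized symmetric 3-cocycle on `A` with values in `M`: the constraints of a skeletal
symmetric monoidal groupoid with objects the elements of `A`, with all automorphism groups equal to
`M`, and with identities as unit constraints. The fields `pentagon` and `hexagon` are the coherence
axioms, and `assoc_zero_mid` is the triangle axiom; the vanishing of `assoc` and `comm` when any
other argument is zero follows. -/
structure SymCocycle (A M : Type*) [AddCommGroup A] [AddCommGroup M] where
  assoc : A → A → A → M
  comm : A → A → M
  assoc_zero_mid : ∀ x z, assoc x 0 z = 0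
  pentagon : ∀ w x y z, assoc w x y + assoc w (x + y) z + assoc x y z =
    assoc (w + x) y z + assoc w x (y + z)
  hexagon : ∀ x y z, assoc x y z + comm x (y + z) + assoc y z x =
    comm x y + assoc y x z + comm x z
  symm : ∀ x y, comm x y + comm y x = 0

namespace SymCocycle

variable {A M : Type*} [AddCommGroup A] [AddCommGroup M]

section
variable (c : SymCocycle A M)

theorem assoc_zero_left (y z : A) : c.assoc 0 y z = 0 := by
  have := c.pentagon 0 0 y z
  simp only [zero_add, c.assoc_zero_mid] at this
  simpa using this

theorem assoc_zero_right (x y : A) : c.assoc x y 0 = 0 := by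
  have := c.pentagon x y 0 0
  simp only [add_zero, c.assoc_zero_mid] at this
  simpa using this

theorem comm_zero_right (x : A) : c.comm x 0 = 0 := by
  have := c.hexagon x 0 0
  simpa [c.assoc_zero_mid, c.assoc_zero_left, c.assoc_zero_right] using this

theorem comm_zero_left (x : A) : c.comm 0 x = 0 := by
  simpa [c.comm_zero_right] using c.symm x 0

end

/-- The objects of the skeletal symmetric monoidal groupoid with constraints `c`: a copy of `A`. -/
@[ext]
structure Obj (c : SymCocycle A M) where
  el : A

variable {c : SymCocycle A M}

/-- A morphism `X ⟶ Y` is an element of `M`, and exists only if `X` and `Y` are equal. -/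
@[ext]
structure Obj.Hom (X Y : c.Obj) where
  eq : X.el = Y.el
  val : M

instance : Category c.Obj where
  Hom := Obj.Hom
  id _ := ⟨rfl, 0⟩
  comp f g := ⟨f.eq.trans g.eq, f.val + g.val⟩
  id_comp _ := Obj.Hom.ext (zero_add _)
  comp_id _ := Obj.Hom.ext (add_zero _)
  assoc _ _ _ := Obj.Hom.ext (add_assoc _ _ _)

/-- The element of `M` that a morphism consists of. -/
def val {X Y : c.Obj} (f : X ⟶ Y) : M := Obj.Hom.val f

@[ext]
theorem hom_ext {X Y : c.Obj} {f g : X ⟶ Y} (h : val f = val g) : f = g := Obj.Hom.ext h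

theorem el_eq {X Y : c.Obj} (f : X ⟶ Y) : X.el = Y.el := Obj.Hom.eq f

@[simp] theorem val_id (X : c.Obj) : val (𝟙 X) = 0 := rfl
@[simp] theorem val_comp {X Y Z : c.Obj} (f : X ⟶ Y) (g : Y ⟶ Z) :
    val (f ≫ g) = val f + val g := rfl

/-- The isomorphism given by an element of `M`. -/
def mkIso {X Y : c.Obj} (h : X.el = Y.el) (m : M) : X ≅ Y where
  hom := (⟨h, m⟩ : Obj.Hom X Y)
  inv := (⟨h.symm, -m⟩ : Obj.Hom Y X)
  hom_inv_id := Obj.Hom.ext (add_neg_cancel m)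
  inv_hom_id := Obj.Hom.ext (neg_add_cancel m)

@[simp] theorem val_mkIso_hom {X Y : c.Obj} (h : X.el = Y.el) (m : M) :
    val (mkIso h m).hom = m := rfl
@[simp] theorem val_mkIso_inv {X Y : c.Obj} (h : X.el = Y.el) (m : M) :
    val (mkIso h m).inv = -m := rfl

instance : IsGroupoid c.Obj where
  all_isIso f := (mkIso (Obj.Hom.eq f) (val f)).isIso_hom

instance : MonoidalCategoryStruct c.Obj where
  tensorObj X Y := ⟨X.el + Y.el⟩
  whiskerLeft X _ _ f := (⟨congrArg (X.el + ·) (Obj.Hom.eq f), val f⟩ : Obj.Hom _ _)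
  whiskerRight f Y := (⟨congrArg (· + Y.el) (Obj.Hom.eq f), val f⟩ : Obj.Hom _ _)
  tensorUnit := ⟨0⟩
  associator X Y Z := mkIso (add_assoc _ _ _) (c.assoc X.el Y.el Z.el)
  leftUnitor _ := mkIso (zero_add _) 0
  rightUnitor _ := mkIso (add_zero _) 0

@[simp] theorem tensor_el (X Y : c.Obj) : (X ⊗ Y).el = X.el + Y.el := rfl
@[simp] theorem unit_el : (𝟙_ c.Obj).el = 0 := rfl
@[simp] theorem val_whiskerLeft (X : c.Obj) {Y Z : c.Obj} (f : Y ⟶ Z) : val (X ◁ f) = val f := rfl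
@[simp] theorem val_whiskerRight {X Y : c.Obj} (f : X ⟶ Y) (Z : c.Obj) : val (f ▷ Z) = val f := rfl
@[simp] theorem val_associator_hom (X Y Z : c.Obj) :
    val (α_ X Y Z).hom = c.assoc X.el Y.el Z.el := rfl
@[simp] theorem val_associator_inv (X Y Z : c.Obj) :
    val (α_ X Y Z).inv = -c.assoc X.el Y.el Z.el := rfl
@[simp] theorem val_leftUnitor_hom (X : c.Obj) : val (λ_ X).hom = 0 := rfl
@[simp] theorem val_rightUnitor_hom (X : c.Obj) : val (ρ_ X).hom = 0 := rfl
@[simp] theorem val_leftUnitor_inv (X : c.Obj) : val (λ_ X).inv = 0 := neg_zero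
@[simp] theorem val_rightUnitor_inv (X : c.Obj) : val (ρ_ X).inv = 0 := neg_zero
@[simp] theorem val_tensorHom {X Y Z W : c.Obj} (f : X ⟶ Y) (g : Z ⟶ W) :
    val (f ⊗ₘ g) = val f + val g := rfl

instance : MonoidalCategory c.Obj where
  tensorHom_def _ _ := rfl
  id_tensorHom_id _ _ := by ext; simp
  tensorHom_comp_tensorHom _ _ _ _ := by ext; simp; abel
  whiskerLeft_id _ _ := by ext; simp
  id_whiskerRight _ _ := by ext; simp
  associator_naturality f g h := by
    ext; simp [el_eq f, el_eq g, el_eq h]; abel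
  leftUnitor_naturality _ := by ext; simp
  rightUnitor_naturality _ := by ext; simp
  pentagon W X Y Z := by ext; simpa [add_assoc] using c.pentagon W.el X.el Y.el Z.el
  triangle X Y := by ext; simp [c.assoc_zero_mid]

instance : SymmetricCategory c.Obj where
  braiding X Y := mkIso (add_comm _ _) (c.comm X.el Y.el)
  braiding_naturality_right _ _ _ f := by ext; simp [el_eq f, add_comm]
  braiding_naturality_left f _ := by ext; simp [el_eq f, add_comm]
  hexagon_forward X Y Z := by ext; simpa [add_assoc] using c.hexagon X.el Y.el Z.el
  hexagon_reverse X Y Z := by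
    ext
    have h := c.hexagon Z.el X.el Y.el
    have h1 := c.symm X.el Z.el
    have h2 := c.symm Y.el Z.el
    have h3 := c.symm (X.el + Y.el) Z.el
    simp
    grind
  symmetry X Y := by ext; simpa using c.symm X.el Y.el

@[simp] theorem val_braiding_hom (X Y : c.Obj) : val (β_ X Y).hom = c.comm X.el Y.el := rfl

end SymCocycle

namespace SymCocycle

variable {A B M : Type*} [AddCommGroup A] [AddCommGroup B] [AddCommGroup M]

/-! ### Coboundaries -/

/-- A 2-cochain is normalized if it vanishes when one of its arguments is zero. -/
structure IsNormalized (γ : A → A → M) : Prop where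
  zero_left : ∀ x, γ 0 x = 0
  zero_right : ∀ x, γ x 0 = 0

/-- The cocycle `c - ∂γ`, where `∂γ` consists of `γ x y + γ (x + y) z - γ y z - γ x (y + z)` and
`γ x y - γ y x`. -/
@[simps]
def subCoboundary (c : SymCocycle A M) (γ : A → A → M) (hγ : IsNormalized γ) :
    SymCocycle A M where
  assoc x y z := c.assoc x y z - (γ x y + γ (x + y) z - γ y z - γ x (y + z))
  comm x y := c.comm x y - (γ x y - γ y x)
  assoc_zero_mid x z := by simp [c.assoc_zero_mid, hγ.zero_left, hγ.zero_right]
  pentagon w x y z := by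
    have := c.pentagon w x y z
    grind
  hexagon x y z := by
    have := c.hexagon x y z
    grind
  symm x y := by
    have := c.symm x y
    grind

/-- The pullback of a cocycle along a homomorphism. -/
@[simps]
def comap (c : SymCocycle A M) (f : B →+ A) : SymCocycle B M where
  assoc x y z := c.assoc (f x) (f y) (f z)
  comm x y := c.comm (f x) (f y)
  assoc_zero_mid x z := by simp [c.assoc_zero_mid]
  pentagon w x y z := by simpa using c.pentagon (f w) (f x) (f y) (f z)
  hexagon x y z := by simpa using c.hexagon (f x) (f y) (f z)
  symm x y := c.symm (f x) (f y)

/-- Both parts of the cocycle vanish on a set. -/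
structure TrivialOn (c : SymCocycle A M) (S : Set A) : Prop where
  assoc_eq : ∀ ⦃x⦄, x ∈ S → ∀ ⦃y⦄, y ∈ S → ∀ ⦃z⦄, z ∈ S → c.assoc x y z = 0
  comm_eq : ∀ ⦃x⦄, x ∈ S → ∀ ⦃y⦄, y ∈ S → c.comm x y = 0

/-- The cocycle is a coboundary. -/
def Trivializable (c : SymCocycle A M) : Prop :=
  ∃ (γ : A → A → M) (hγ : IsNormalized γ), (c.subCoboundary γ hγ).TrivialOn Set.univ

/-! ### Cocycles on the integers -/

theorem exists_int_primitive (f : ℤ → M) : ∃ P : ℤ → M, P 0 = 0 ∧ ∀ n, P (n + 1) = P n + f n := by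
  refine ⟨fun n => match n with
    | Int.ofNat n => ∑ k ∈ Finset.range n, f k
    | Int.negSucc n => -∑ k ∈ Finset.range (n + 1), f (Int.negSucc k), by simp, fun n => ?_⟩
  match n with
  | Int.ofNat n => exact Finset.sum_range_succ (fun k : ℕ => f k) n
  | Int.negSucc 0 => simp
  | Int.negSucc (n + 1) =>
    change -∑ k ∈ Finset.range (n + 1), f (Int.negSucc k) = -∑ k ∈ Finset.range (n + 1 + 1), _ + _
    rw [Finset.sum_range_succ _ (n + 1)]
    abel

/-- Requiring `γ m 1 = 0` makes `γ m` a primitive of `-c.assoc m · 1`. The cocycle `d = c - ∂γ` then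
has `d.assoc m n 1 = 0`, whence `d.assoc = 0` by the pentagon; so `d.comm` is biadditive by the
hexagon, and is determined by `d.comm 1 1 = 0`. -/
theorem trivializable_int (c : SymCocycle ℤ M) (hc : ∀ x, c.comm x x = 0) : c.Trivializable := by
  choose P hP0 hP using fun m => exists_int_primitive (fun n => -c.assoc m n 1)
  have hn : IsNormalized P := by
    refine ⟨fun n => ?_, hP0⟩
    induction n using Int.induction_on with
    | zero => exact hP0 0
    | succ n ih => rw [hP, ih, c.assoc_zero_left]; simp
    | pred n ih =>
      have := hP 0 (-n - 1)
      rw [sub_add_cancel, ih, c.assoc_zero_left] at this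
      simpa using this.symm
  have hP1 : ∀ m, P m 1 = 0 := fun m => by
    have := hP m 0
    rw [zero_add, hP0, c.assoc_zero_mid] at this
    simpa using this
  refine ⟨P, hn, ?_⟩
  have h1 : ∀ m n, (c.subCoboundary P hn).assoc m n 1 = 0 := fun m n => by
    simp [hP, hP1]
  have hcomm : ∀ x, (c.subCoboundary P hn).comm x x = 0 := fun x => by simp [hc]
  generalize c.subCoboundary P hn = d at h1 hcomm
  have hstep : ∀ m n k, d.assoc m n (k + 1) = d.assoc m n k := fun m n k => by
    have := d.pentagon m n k 1
    simpa [h1] using this.symm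
  have hassoc : ∀ m n k, d.assoc m n k = 0 := fun m n k => by
    induction k using Int.induction_on with
    | zero => exact d.assoc_zero_right m n
    | succ k ih => rw [hstep, ih]
    | pred k ih => rw [← hstep, sub_add_cancel, ih]
  have hadd : ∀ x y z, d.comm x (y + z) = d.comm x y + d.comm x z := fun x y z => by
    simpa [hassoc] using d.hexagon x y z
  have hsm : ∀ x n : ℤ, d.comm x n = n • d.comm x 1 := fun x n => by
    simpa using map_zsmul (AddMonoidHom.mk' (d.comm x) (hadd x)) n 1
  refine ⟨fun _ _ _ _ _ _ => hassoc _ _ _, fun x _ y _ => ?_⟩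
  rw [hsm, eq_neg_of_add_eq_zero_left (d.symm x 1), hsm 1 x, hcomm]
  simp

/-! ### Direct sums -/

/-- The value of the canonical isomorphism `(x₁ x₂) (y₁ y₂) ≅ (x₁ y₁) (x₂ y₂)` of the skeletal
symmetric monoidal groupoid. It is the 2-cochain that trivializes `c` on a direct sum once `c` is
trivial on both summands, because the tensor product is a symmetric monoidal functor. -/
def interchange (c : SymCocycle A M) (x₁ x₂ y₁ y₂ : A) : M :=
  c.assoc x₁ x₂ (y₁ + y₂) - c.assoc x₂ y₁ y₂ + c.comm x₂ y₁ + c.assoc y₁ x₂ y₂ -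
    c.assoc x₁ y₁ (x₂ + y₂)

theorem val_tensorμ (c : SymCocycle A M) (X₁ X₂ Y₁ Y₂ : c.Obj) :
    val (tensorμ X₁ X₂ Y₁ Y₂) = c.interchange X₁.el X₂.el Y₁.el Y₂.el := by
  simp [tensorμ, interchange]
  abel

theorem interchange_assoc (c : SymCocycle A M) (x₁ x₂ y₁ y₂ z₁ z₂ : A) :
    c.interchange x₁ x₂ y₁ y₂ + c.interchange (x₁ + y₁) (x₂ + y₂) z₁ z₂ +
      (c.assoc x₁ y₁ z₁ + c.assoc x₂ y₂ z₂) =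
    c.assoc (x₁ + x₂) (y₁ + y₂) (z₁ + z₂) + c.interchange y₁ y₂ z₁ z₂ +
      c.interchange x₁ x₂ (y₁ + z₁) (y₂ + z₂) := by
  have := congrArg val (tensor_associativity (C := c.Obj) ⟨x₁⟩ ⟨x₂⟩ ⟨y₁⟩ ⟨y₂⟩ ⟨z₁⟩ ⟨z₂⟩)
  simp only [val_comp, val_whiskerRight, val_whiskerLeft, val_tensorHom, val_associator_hom,
    val_tensorμ, tensor_el] at this
  simpa only [add_assoc] using this

theorem interchange_comm (c : SymCocycle A M) (x₁ x₂ y₁ y₂ : A) :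
    c.interchange x₁ x₂ y₁ y₂ + (c.comm x₁ y₁ + c.comm x₂ y₂) =
      c.comm (x₁ + x₂) (y₁ + y₂) + c.interchange y₁ y₂ x₁ x₂ := by
  have : ∀ X₁ X₂ Y₁ Y₂ : c.Obj, tensorμ X₁ X₂ Y₁ Y₂ ≫ ((β_ X₁ Y₁).hom ⊗ₘ (β_ X₂ Y₂).hom) =
      (β_ (X₁ ⊗ X₂) (Y₁ ⊗ Y₂)).hom ≫ tensorμ Y₁ Y₂ X₁ X₂ := fun X₁ X₂ Y₁ Y₂ => by
    simp [tensorμ, SymmetricCategory.braiding_swap_eq_inv_braiding X₁ Y₂,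
      MonoidalCategory.tensorHom_def]
  have := congrArg val (this ⟨x₁⟩ ⟨x₂⟩ ⟨y₁⟩ ⟨y₂⟩)
  simpa only [val_comp, val_tensorHom, val_braiding_hom, val_tensorμ, tensor_el] using this

end SymCocycle

namespace SymCocycle

variable {A B M : Type*} [AddCommGroup A] [AddCommGroup B] [AddCommGroup M]

theorem isNormalized_interchange (c : SymCocycle A M) (p q : A →+ A) :
    IsNormalized fun x y => c.interchange (p x) (q x) (p y) (q y) := by
  constructor <;> intro x <;>
  simp [interchange, c.assoc_zero_left, c.assoc_zero_mid, c.assoc_zero_right, c.comm_zero_left,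
    c.comm_zero_right]

theorem trivialOn_interchange (c : SymCocycle A M) (p q : A →+ A) (hpq : ∀ x, p x + q x = x)
    {S T U : Set A} (hS : c.TrivialOn S) (hT : c.TrivialOn T) (hp : ∀ x ∈ U, p x ∈ S)
    (hq : ∀ x ∈ U, q x ∈ T) :
    (c.subCoboundary _ (c.isNormalized_interchange p q)).TrivialOn U := by
  refine ⟨fun x hx y hy z hz => ?_, fun x hx y hy => ?_⟩
  · have := c.interchange_assoc (p x) (q x) (p y) (q y) (p z) (q z)
    rw [hS.assoc_eq (hp x hx) (hp y hy) (hp z hz), hT.assoc_eq (hq x hx) (hq y hy) (hq z hz),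
      hpq, hpq, hpq] at this
    simp only [subCoboundary_assoc, map_add]
    grind
  · have := c.interchange_comm (p x) (q x) (p y) (q y)
    rw [hS.comm_eq (hp x hx) (hp y hy), hT.comm_eq (hq x hx) (hq y hy), hpq, hpq] at this
    simp only [subCoboundary_comm]
    grind

theorem IsNormalized.add {γ δ : A → A → M} (hγ : IsNormalized γ) (hδ : IsNormalized δ) :
    IsNormalized (γ + δ) :=
  ⟨fun x => by simp [hγ.zero_left, hδ.zero_left], fun x => by simp [hγ.zero_right, hδ.zero_right]⟩

theorem subCoboundary_add (c : SymCocycle A M) {γ δ : A → A → M} (hγ : IsNormalized γ)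
    (hδ : IsNormalized δ) {S : Set A}
    (h : ((c.subCoboundary γ hγ).subCoboundary δ hδ).TrivialOn S) :
    (c.subCoboundary _ (hγ.add hδ)).TrivialOn S := by
  refine ⟨fun x hx y hy z hz => ?_, fun x hx y hy => ?_⟩
  · have := h.assoc_eq hx hy hz
    simp only [subCoboundary_assoc, Pi.add_apply] at this ⊢
    grind
  · have := h.comm_eq hx hy
    simp only [subCoboundary_comm, Pi.add_apply] at this ⊢
    grind

/-! ### Free abelian groups -/

section Free

variable {I : Type*}

/-- The elements of the free abelian group on `I` that are supported in `J`. -/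
def supported (J : Set I) : Set (I →₀ ℤ) := {x | ∀ i ∉ J, x i = 0}

/-- A trivialization of `c` on the elements supported in `dom`. The cochain `γ` is defined
and normalized everywhere, but beyond that only its values on these elements matter. -/
structure PartialTriv (c : SymCocycle (I →₀ ℤ) M) where
  dom : Set I
  γ : (I →₀ ℤ) → (I →₀ ℤ) → M
  normalized : IsNormalized γ
  trivialOn : (c.subCoboundary γ normalized).TrivialOn (supported dom)

/-- Extension of partial trivializations. -/
def PartialTriv.Le {c : SymCocycle (I →₀ ℤ) M} (p q : c.PartialTriv) : Prop :=
  p.dom ⊆ q.dom ∧ ∀ x ∈ supported p.dom, ∀ y ∈ supported p.dom, p.γ x y = q.γ x y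

theorem supported_mono {J K : Set I} (h : J ⊆ K) : supported J ⊆ supported K :=
  fun _ hx i hi => hx i fun hJ => hi (h hJ)

theorem supported_add {J : Set I} {x y : I →₀ ℤ} (hx : x ∈ supported J) (hy : y ∈ supported J) :
    x + y ∈ supported J := fun i hi => by simp [hx i hi, hy i hi]

theorem PartialTriv.Le.trans {c : SymCocycle (I →₀ ℤ) M} {p q r : c.PartialTriv} (h : p.Le q)
    (h' : q.Le r) : p.Le r :=
  ⟨h.1.trans h'.1, fun x hx y hy => (h.2 x hx y hy).trans
    (h'.2 x (supported_mono h.1 hx) y (supported_mono h.1 hy))⟩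

theorem TrivialOn.mono {c : SymCocycle A M} {S T : Set A} (h : c.TrivialOn T) (hST : S ⊆ T) :
    c.TrivialOn S :=
  ⟨fun _ hx _ hy _ hz => h.assoc_eq (hST hx) (hST hy) (hST hz),
    fun _ hx _ hy => h.comm_eq (hST hx) (hST hy)⟩

theorem TrivialOn.congr {c : SymCocycle A M} {γ δ : A → A → M} {hγ : IsNormalized γ}
    (hδ : IsNormalized δ) {S : Set A} (h : (c.subCoboundary γ hγ).TrivialOn S)
    (hadd : ∀ x ∈ S, ∀ y ∈ S, x + y ∈ S) (heq : ∀ x ∈ S, ∀ y ∈ S, γ x y = δ x y) :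
    (c.subCoboundary δ hδ).TrivialOn S := by
  refine ⟨fun x hx y hy z hz => ?_, fun x hx y hy => ?_⟩
  · have := h.assoc_eq hx hy hz
    simpa only [subCoboundary_assoc, heq x hx y hy, heq y hy z hz, heq _ (hadd x hx y hy) z hz,
      heq x hx _ (hadd y hy z hz)] using this
  · have := h.comm_eq hx hy
    simpa only [subCoboundary_comm, heq x hx y hy, heq y hy x hx] using this

theorem PartialTriv.exists_upper_bound {c : SymCocycle (I →₀ ℤ) M} (C : Set c.PartialTriv)
    (hC : IsChain PartialTriv.Le C) : ∃ q : c.PartialTriv, ∀ p ∈ C, p.Le q := by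
  classical
  -- an upper bound of the empty chain
  let q₀ : c.PartialTriv := ⟨∅, 0, ⟨fun _ => rfl, fun _ => rfl⟩, by
    have h0 : ∀ x ∈ supported (∅ : Set I), x = 0 := fun x hx => Finsupp.ext fun i => hx i (by simp)
    refine ⟨fun x hx y hy z hz => ?_, fun x hx y hy => ?_⟩
    · rw [h0 x hx, assoc_zero_left]
    · rw [h0 x hx, comm_zero_left]⟩
  rcases C.eq_empty_or_nonempty with rfl | ⟨p₀, hp₀⟩
  · exact ⟨q₀, by simp⟩
  have htot : ∀ p ∈ C, ∀ q ∈ C, p.Le q ∨ q.Le p := fun p hp q hq => by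
    by_cases h : p = q
    · subst h; exact Or.inl ⟨subset_rfl, fun _ _ _ _ => rfl⟩
    · exact hC hp hq h
  have hcover : ∀ x ∈ supported (⋃ p ∈ C, p.dom), ∃ p ∈ C, x ∈ supported p.dom := by
    intro x hx
    have : ∀ s : Finset I, (∀ i ∈ s, i ∈ ⋃ p ∈ C, p.dom) → ∃ p ∈ C, ∀ i ∈ s, i ∈ p.dom := by
      intro s
      induction s using Finset.induction_on with
      | empty => exact fun _ => ⟨p₀, hp₀, by simp⟩
      | insert i s _ ih =>
        intro hs
        obtain ⟨p, hp, hps⟩ := ih fun j hj => hs j (Finset.mem_insert_of_mem hj)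
        obtain ⟨q, hq, hqi⟩ := Set.mem_iUnion₂.1 (hs i (Finset.mem_insert_self i s))
        rcases htot p hp q hq with h | h
        · exact ⟨q, hq, fun j hj => (Finset.mem_insert.1 hj).elim (fun e => e ▸ hqi)
            fun hj => h.1 (hps j hj)⟩
        · exact ⟨p, hp, fun j hj => (Finset.mem_insert.1 hj).elim (fun e => e ▸ h.1 hqi) (hps j)⟩
    obtain ⟨p, hp, h⟩ := this x.support fun i hi => by
      by_contra hJ
      exact Finsupp.mem_support_iff.1 hi (hx i hJ)
    refine ⟨p, hp, fun i hi => ?_⟩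
    by_contra h0
    exact hi (h i (Finsupp.mem_support_iff.2 h0))
  have hcover₂ : ∀ x ∈ supported (⋃ p ∈ C, p.dom), ∀ y ∈ supported (⋃ p ∈ C, p.dom),
      ∃ p ∈ C, x ∈ supported p.dom ∧ y ∈ supported p.dom := by
    intro x hx y hy
    obtain ⟨p, hp, hpx⟩ := hcover x hx
    obtain ⟨q, hq, hqy⟩ := hcover y hy
    rcases htot p hp q hq with h | h
    · exact ⟨q, hq, supported_mono h.1 hpx, hqy⟩
    · exact ⟨p, hp, hpx, supported_mono h.1 hqy⟩
  let γ : (I →₀ ℤ) → (I →₀ ℤ) → M := fun x y =>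
    if h : ∃ p ∈ C, x ∈ supported p.dom ∧ y ∈ supported p.dom then h.choose.γ x y else 0
  have hγ : ∀ p ∈ C, ∀ x ∈ supported p.dom, ∀ y ∈ supported p.dom, p.γ x y = γ x y := by
    intro p hp x hx y hy
    have h : ∃ p ∈ C, x ∈ supported p.dom ∧ y ∈ supported p.dom := ⟨p, hp, hx, hy⟩
    simp only [γ, dif_pos h]
    obtain ⟨hq, hqx, hqy⟩ := h.choose_spec
    rcases htot p hp _ hq with h' | h'
    · exact h'.2 x hx y hy
    · exact (h'.2 x hqx y hqy).symm
  have hn : IsNormalized γ := by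
    constructor <;> intro x <;> simp only [γ] <;> split
    · exact IsNormalized.zero_left (PartialTriv.normalized _) x
    · rfl
    · exact IsNormalized.zero_right (PartialTriv.normalized _) x
    · rfl
  have hp : ∀ p ∈ C, (c.subCoboundary γ hn).TrivialOn (supported p.dom) := fun p hp =>
    p.trivialOn.congr hn (fun x hx y hy => supported_add hx hy) (hγ p hp)
  refine ⟨⟨⋃ p ∈ C, p.dom, γ, hn, fun x hx y hy z hz => ?_, fun x hx y hy => ?_⟩, fun p hp =>
    ⟨Set.subset_biUnion_of_mem (u := fun p : c.PartialTriv => p.dom) hp, hγ p hp⟩⟩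
  · obtain ⟨p, hpC, hpx, hpy⟩ := hcover₂ x hx y hy
    obtain ⟨q, hqC, hqz⟩ := hcover z hz
    rcases htot p hpC q hqC with h | h
    · exact (hp q hqC).assoc_eq (supported_mono h.1 hpx) (supported_mono h.1 hpy) hqz
    · exact (hp p hpC).assoc_eq hpx hpy (supported_mono h.1 hqz)
  · obtain ⟨p, hpC, hpx, hpy⟩ := hcover₂ x hx y hy
    exact (hp p hpC).comm_eq hpx hpy

/-- One more generator `i` is added by trivializing the cocycle on the multiples of `i`, and then on
the direct sum. Both corrections vanish on the elements supported in `p.dom`. -/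
theorem PartialTriv.exists_extension {c : SymCocycle (I →₀ ℤ) M} (hc : ∀ x, c.comm x x = 0)
    (p : c.PartialTriv) (i : I) (hi : i ∉ p.dom) : ∃ q : c.PartialTriv, p.Le q ∧ i ∈ q.dom := by
  classical
  let d := c.subCoboundary p.γ p.normalized
  have hd : ∀ x, d.comm x x = 0 := fun x => by simp [d, hc]
  obtain ⟨g, hg, hgt⟩ := (d.comap (Finsupp.singleAddHom i)).trivializable_int
    fun x => hd _
  let γ₁ : (I →₀ ℤ) → (I →₀ ℤ) → M := fun x y => g (x i) (y i)
  have hγ₁ : IsNormalized γ₁ := ⟨fun x => hg.zero_left _, fun x => hg.zero_right _⟩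
  let e := d.subCoboundary γ₁ hγ₁
  have heJ : e.TrivialOn (supported p.dom) := by
    refine ⟨fun x hx y hy z hz => ?_, fun x hx y hy => ?_⟩
    · have h := p.trivialOn.assoc_eq hx hy hz
      change d.assoc x y z = 0 at h
      simp [e, γ₁, h, hx i hi, hy i hi, hg.zero_left]
    · have h := p.trivialOn.comm_eq hx hy
      change d.comm x y = 0 at h
      simp [e, γ₁, h, hx i hi, hy i hi]
  have hei : e.TrivialOn (Set.range (Finsupp.single i)) := by
    constructor
    · rintro _ ⟨x, rfl⟩ _ ⟨y, rfl⟩ _ ⟨z, rfl⟩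
      simpa [e, γ₁] using hgt.assoc_eq (Set.mem_univ x) (Set.mem_univ y) (Set.mem_univ z)
    · rintro _ ⟨x, rfl⟩ _ ⟨y, rfl⟩
      simpa [e, γ₁] using hgt.comm_eq (Set.mem_univ x) (Set.mem_univ y)
  have hn := e.isNormalized_interchange (Finsupp.eraseAddHom i)
    ((Finsupp.singleAddHom i).comp (Finsupp.applyAddHom i))
  have ht := e.trivialOn_interchange (Finsupp.eraseAddHom i)
    ((Finsupp.singleAddHom i).comp (Finsupp.applyAddHom i))
    (fun x => Finsupp.erase_add_single i x) heJ hei (U := supported (insert i p.dom))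
    (fun x hx j hj => by
      by_cases hji : j = i
      · subst hji; simp
      · simpa [Finsupp.erase_ne hji] using hx j (by simp [hji, hj]))
    (fun x _ => ⟨x i, rfl⟩)
  refine ⟨⟨insert i p.dom, _, p.normalized.add (hγ₁.add hn),
    c.subCoboundary_add p.normalized (hγ₁.add hn) (d.subCoboundary_add hγ₁ hn ht)⟩,
    ⟨Set.subset_insert _ _, ?_⟩, Set.mem_insert _ _⟩
  · intro x hx y hy
    simp [γ₁, hx i hi, hy i hi, hg.zero_left, interchange, assoc_zero_left, assoc_zero_mid,
      assoc_zero_right, comm_zero_left]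

/-- Zorn's lemma, applied to the partial trivializations. -/
theorem trivializable_finsupp (c : SymCocycle (I →₀ ℤ) M) (hc : ∀ x, c.comm x x = 0) :
    c.Trivializable := by
  obtain ⟨p, hp⟩ := exists_maximal_of_chains_bounded
    PartialTriv.exists_upper_bound (fun h h' => PartialTriv.Le.trans h h') (α := c.PartialTriv)
  refine ⟨p.γ, p.normalized, p.trivialOn.mono fun x _ i hi => ?_⟩
  obtain ⟨q, hpq, hiq⟩ := p.exists_extension hc i hi
  exact absurd ((hp q hpq).1 hiq) hi

end Free

end SymCocycle

/-! ### Symmetric 2-cocycles and extensions of abelian groups -/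

/-- A symmetric 2-cocycle: the factor set of an extension of `A` by `M` that is an abelian group. It
is not required to be normalized. -/
structure IsSymTwoCocycle {A M : Type*} [AddCommGroup A] [AddCommGroup M] (g : A → A → M) :
    Prop where
  assoc : ∀ x y z, g x y + g (x + y) z = g y z + g x (y + z)
  symm : ∀ x y, g x y = g y x

/-- Every symmetric 2-cocycle is a coboundary; equivalently `Ext¹(A, M) = 0`. -/
def SplitsTwoCocycles (A M : Type*) [AddCommGroup A] [AddCommGroup M] : Prop :=
  ∀ g : A → A → M, IsSymTwoCocycle g → ∃ φ : A → M, ∀ x y, g x y = φ x + φ y - φ (x + y)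

namespace IsSymTwoCocycle

variable {A M : Type*} [AddCommGroup A] [AddCommGroup M] {g : A → A → M}

theorem zero_left (hg : IsSymTwoCocycle g) (x : A) : g 0 x = g 0 0 := by
  simpa using (hg.assoc 0 0 x).symm

/-- The extension of `A` by `M` with factor set `g`: the set `A × M` with the addition
`(a, m) + (b, n) = (a + b, m + n + g a b)`. -/
@[ext]
structure Extension (hg : IsSymTwoCocycle g) where
  fst : A
  snd : M

variable {hg : IsSymTwoCocycle g}

instance : Add hg.Extension := ⟨fun x y => ⟨x.fst + y.fst, x.snd + y.snd + g x.fst y.fst⟩⟩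
instance : Zero hg.Extension := ⟨⟨0, -g 0 0⟩⟩
instance : Neg hg.Extension := ⟨fun x => ⟨-x.fst, -x.snd - g x.fst (-x.fst) - g 0 0⟩⟩

theorem Extension.add_def (x y : hg.Extension) :
    x + y = ⟨x.fst + y.fst, x.snd + y.snd + g x.fst y.fst⟩ := rfl
theorem Extension.zero_def : (0 : hg.Extension) = ⟨0, -g 0 0⟩ := rfl
theorem Extension.neg_def (x : hg.Extension) :
    -x = ⟨-x.fst, -x.snd - g x.fst (-x.fst) - g 0 0⟩ := rfl

instance : AddCommGroup hg.Extension where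
  add_assoc x y z := by
    have := hg.assoc x.fst y.fst z.fst
    ext
    · exact add_assoc _ _ _
    · simp only [Extension.add_def]
      grind
  zero_add x := by
    ext
    · exact zero_add _
    · simp [Extension.add_def, Extension.zero_def, hg.zero_left x.fst]
  add_zero x := by
    ext
    · exact add_zero _
    · simp [Extension.add_def, Extension.zero_def, hg.symm x.fst 0, hg.zero_left x.fst]
  neg_add_cancel x := by
    ext
    · exact neg_add_cancel _
    · simp [Extension.add_def, Extension.zero_def, Extension.neg_def, hg.symm (-x.fst) x.fst]
      abel
  add_comm x y := by
    ext
    · exact add_comm _ _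
    · simp only [Extension.add_def]
      rw [hg.symm, add_comm x.snd]
  nsmul := nsmulRec
  zsmul := zsmulRec

/-- The projection of the extension to `A`. -/
def Extension.proj : hg.Extension →+ A where
  toFun := Extension.fst
  map_zero' := rfl
  map_add' _ _ := rfl

variable (hg) in
/-- The inclusion of `M` in the extension. The shift is needed because `g` is not normalized. -/
def Extension.incl : M →+ hg.Extension where
  toFun m := ⟨0, m - g 0 0⟩
  map_zero' := by simp [Extension.zero_def]
  map_add' m n := by
    ext
    · exact (add_zero _).symm
    · simp only [Extension.add_def]
      abel

end IsSymTwoCocycle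

open IsSymTwoCocycle

/-- A section of the extension trivializes its factor set. -/
theorem splitsTwoCocycles_of_projective (A M : Type*) [AddCommGroup A] [AddCommGroup M]
    [Module.Projective ℤ A] : SplitsTwoCocycles A M := by
  intro g hg
  obtain ⟨s, hs⟩ := Module.projective_lifting_property
    (Extension.proj (hg := hg)).toIntLinearMap LinearMap.id fun x => ⟨⟨x, 0⟩, rfl⟩
  have hs' : ∀ x, (s x).fst = x := fun x => LinearMap.congr_fun hs x
  refine ⟨fun x => -(s x).snd, fun x y => ?_⟩
  simp only [map_add, Extension.add_def, hs']
  abel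

/-- An abelian group is divisible if multiplication by every nonzero natural number is onto. -/
def IsDivisible (M : Type*) [AddCommGroup M] : Prop :=
  ∀ n : ℕ, n ≠ 0 → ∀ m : M, ∃ m' : M, n • m' = m

theorem IsDivisible.exists_extension {M : Type*} [AddCommGroup M] (hM : IsDivisible M)
    {X Y : Type*} [AddCommGroup X] [AddCommGroup Y] (f : X →+ Y) (hf : Function.Injective f)
    (g : X →+ M) : ∃ h : Y →+ M, h.comp f = g := by
  let : DivisibleBy M ℕ := divisibleByOfSMulRightSurj M ℕ fun hn m => hM _ hn m
  let : DivisibleBy M ℤ := AddGroup.divisibleByIntOfDivisibleByNat M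
  exact (Module.Baer.of_divisible M).extension_property_addMonoidHom f hf g

/-- A retraction of the extension onto `M` trivializes its factor set. -/
theorem IsDivisible.splitsTwoCocycles {M : Type*} [AddCommGroup M] (hM : IsDivisible M)
    (A : Type*) [AddCommGroup A] : SplitsTwoCocycles A M := by
  intro g hg
  have hinj : Function.Injective (Extension.incl hg) := fun m n h =>
    sub_left_injective (congrArg Extension.snd h)
  obtain ⟨ρ, hρ⟩ := hM.exists_extension (Extension.incl hg) hinj (AddMonoidHom.id M)
  refine ⟨fun x => ρ ⟨x, 0⟩, fun x y => ?_⟩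
  have h : (⟨x, 0⟩ + ⟨y, 0⟩ : hg.Extension) = ⟨x + y, 0⟩ + Extension.incl hg (g x y) := by
    ext
    · exact (add_zero _).symm
    · simp [Extension.add_def, Extension.incl, hg.symm (x + y) 0, hg.zero_left (x + y)]
  have h' := congrArg ρ h
  rw [map_add, map_add, show ρ (Extension.incl hg (g x y)) = g x y from
    DFunLike.congr_fun hρ (g x y)] at h'
  rw [h', add_sub_cancel_left]

/-- The evaluation map into a power of `ℚ / ℤ`, indexed by the characters of `M`. -/
theorem IsDivisible.exists_embedding (M : Type u) [AddCommGroup M] :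
    ∃ (Q : Type u) (_ : AddCommGroup Q) (f : M →+ Q), IsDivisible Q ∧ Function.Injective f := by
  refine ⟨CharacterModule M → AddCircle (1 : ℚ), inferInstance,
    AddMonoidHom.pi fun χ => χ, fun n hn q => ⟨fun χ => DivisibleBy.div (q χ) (n : ℤ),
      funext fun χ => by
      simpa using DivisibleBy.div_cancel (q χ) (Nat.cast_ne_zero (R := ℤ).2 hn)⟩, ?_⟩
  rw [injective_iff_map_eq_zero]
  intro m hm
  exact CharacterModule.eq_zero_of_character_apply fun χ => congrFun hm χ

/-! ### Triviality of the alternating cocycles -/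

namespace SymCocycle

variable {A F M : Type*} [AddCommGroup A] [AddCommGroup F] [AddCommGroup M]

theorem Trivializable.of_comap_equiv {c : SymCocycle A M} (e : F ≃+ A)
    (h : (c.comap e.toAddMonoidHom).Trivializable) : c.Trivializable := by
  obtain ⟨γ, hγ, ht⟩ := h
  refine ⟨fun x y => γ (e.symm x) (e.symm y), ⟨fun x => by simp [hγ.zero_left], fun x => by
    simp [hγ.zero_right]⟩, fun x _ y _ z _ => ?_, fun x _ y _ => ?_⟩
  · simpa using ht.assoc_eq (Set.mem_univ (e.symm x)) (Set.mem_univ (e.symm y))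
      (Set.mem_univ (e.symm z))
  · simpa using ht.comm_eq (Set.mem_univ (e.symm x)) (Set.mem_univ (e.symm y))

theorem trivializable_of_free [Module.Free ℤ A] (c : SymCocycle A M) (hc : ∀ x, c.comm x x = 0) :
    c.Trivializable :=
  .of_comap_equiv (Module.Free.chooseBasis ℤ A).repr.symm.toAddEquiv
    (trivializable_finsupp _ fun _ => hc _)

/-- A trivialization of the pullback of `c` along a surjection `p : F → A` descends to `A` after a
correction by a coboundary `∂φ`, if the symmetric 2-cocycles on the kernel split: the trivialization
`γ` restricts to a symmetric 2-cocycle on the kernel, and `φ` is chosen such that `γ - ∂φ` vanishes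
when its second argument is in the kernel. Then `γ - ∂φ` only depends on the images in `A`. -/
theorem Trivializable.of_comap {c : SymCocycle A M} (p : F →+ A) (hp : Function.Surjective p)
    (hsplit : SplitsTwoCocycles p.ker M) (h : (c.comap p).Trivializable) : c.Trivializable := by
  classical
  obtain ⟨γ, hγ, ht⟩ := h
  have hassoc : ∀ x y z, c.assoc (p x) (p y) (p z) = γ x y + γ (x + y) z - γ y z - γ x (y + z) :=
    fun x y z => sub_eq_zero.1 (ht.assoc_eq (Set.mem_univ x) (Set.mem_univ y) (Set.mem_univ z))
  have hcomm : ∀ x y, c.comm (p x) (p y) = γ x y - γ y x :=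
    fun x y => sub_eq_zero.1 (ht.comm_eq (Set.mem_univ x) (Set.mem_univ y))
  have hassoc0 : ∀ x y r, p r = 0 → γ x y + γ (x + y) r - γ y r - γ x (y + r) = 0 :=
    fun x y r hr => by rw [← hassoc, hr, c.assoc_zero_right]
  obtain ⟨φ₀, hφ₀⟩ := hsplit (fun r r' => γ r r') ⟨fun x y z => by
      have := hassoc0 x y z z.2
      push_cast
      grind, fun x y => by
      have := hcomm x y
      rw [x.2, y.2, c.comm_zero_left] at this
      exact sub_eq_zero.1 this.symm⟩
  -- a section of `p`, normalized at zero
  obtain ⟨s, hs0, hs⟩ : ∃ s : A → F, s 0 = 0 ∧ ∀ a, p (s a) = a := by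
    choose s hs using hp
    refine ⟨fun a => if a = 0 then 0 else s a, if_pos rfl, fun a => ?_⟩
    by_cases h : a = 0 <;> simp [h, hs]
  have hφ₀0 : φ₀ 0 = 0 := by
    simpa [hγ.zero_left] using (hφ₀ 0 0).symm
  -- every `x` is `s (p x) + res x`, and `φ` is forced by its restriction `φ₀` to the kernel, up to
  -- its values on the image of the section, which are taken to be zero
  let res : F → p.ker := fun x => ⟨x - s (p x), by simp [AddMonoidHom.mem_ker, hs]⟩
  let φ : F → M := fun x => φ₀ (res x) - γ (s (p x)) (res x)
  have hφr : ∀ r : p.ker, φ r = φ₀ r := fun r => by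
    have h : res r = r := Subtype.ext (by simp [res, AddMonoidHom.mem_ker.1 r.2, hs0])
    simp only [φ, h, AddMonoidHom.mem_ker.1 r.2, hs0, hγ.zero_left, sub_zero]
  have hφ : ∀ x r, p r = 0 → γ x r = φ x + φ r - φ (x + r) := fun x r hr => by
    have hpx : p (x + r) = p x := by rw [map_add, hr, add_zero]
    have h1 : res (x + r) = res x + ⟨r, hr⟩ := Subtype.ext (by simp [res, hpx]; abel)
    have h2 := hφ₀ (res x) ⟨r, hr⟩
    have h3 := hassoc0 (s (p x)) (res x) r hr
    have h4 : s (p x) + (res x : F) = x := by simp [res]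
    rw [h4] at h3
    have h5 := hφr ⟨r, hr⟩
    simp only at h5
    simp only [φ, h1] at h5 ⊢
    rw [h5, hpx]
    push_cast
    simp only at h2
    grind
  -- the corrected 2-cochain descends to the quotient
  let δ : F → F → M := fun x y => γ x y - (φ x + φ y - φ (x + y))
  have hδassoc : ∀ x y z, c.assoc (p x) (p y) (p z) = δ x y + δ (x + y) z - δ y z - δ x (y + z) :=
    fun x y z => by
      rw [hassoc]; simp only [δ, add_assoc]; abel
  have hδcomm : ∀ x y, c.comm (p x) (p y) = δ x y - δ y x := fun x y => by
    rw [hcomm]; simp only [δ, add_comm y x]; abel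
  have hδ0 : ∀ x r, p r = 0 → δ x r = 0 := fun x r hr => sub_eq_zero.2 (hφ x r hr)
  have hδr : ∀ x y r, p r = 0 → δ x (y + r) = δ x y := fun x y r hr => by
    have := hδassoc x y r
    rw [hr, c.assoc_zero_right, hδ0 _ _ hr, hδ0 _ _ hr] at this
    grind
  have hδright : ∀ x y z, p y = p z → δ x y = δ x z := fun x y z h => by
    have := hδr x z (y - z) (by rw [map_sub, h, sub_self])
    rwa [add_sub_cancel] at this
  have hδleft : ∀ x y z, p x = p y → δ x z = δ y z := fun x y z h => by
    have h1 := hδcomm x z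
    have h2 := hδcomm y z
    rw [h] at h1
    rw [hδright z x y h] at h1
    exact sub_left_injective (h1.symm.trans h2)
  have hn : IsNormalized fun a b => δ (s a) (s b) := by
    have h0 : ∀ x, δ (s x) (s 0) = 0 := fun x => hδ0 _ _ (by rw [hs])
    refine ⟨fun x => ?_, h0⟩
    have := hδcomm (s 0) (s x)
    rw [hs, comm_zero_left, h0, sub_zero] at this
    exact this.symm
  refine ⟨_, hn, fun x _ y _ z _ => ?_, fun x _ y _ => ?_⟩
  · have := hδassoc (s x) (s y) (s z)
    rw [hδleft (s x + s y) (s (x + y)) _ (by simp [hs]),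
      hδright _ (s y + s z) (s (y + z)) (by simp [hs]), hs, hs, hs] at this
    exact sub_eq_zero.2 this
  · have := hδcomm (s x) (s y)
    rw [hs, hs] at this
    exact sub_eq_zero.2 this

theorem trivializable_of_isDivisible (hM : IsDivisible M) (c : SymCocycle A M)
    (hc : ∀ x, c.comm x x = 0) : c.Trivializable := by
  refine .of_comap (Finsupp.liftAddHom fun a : A => (zmultiplesHom A a : ℤ →+ A))
    (fun a => ⟨Finsupp.single a 1, by simp⟩) (hM.splitsTwoCocycles _)
    (trivializable_finsupp _ fun _ => hc _)

end SymCocycle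

namespace SymCatGr

/-! ### Degrees of morphisms, and the cocycle of a symmetric categorical group -/

theorem Pi1.mk_mul {S : SymCatGr.{u}} (a b : Aut (𝟙_ S.carrier)) :
    Pi1.mk (a * b) = Pi1.mk a + Pi1.mk b := rfl

theorem Pi0.mk_tensor {S : SymCatGr.{u}} (X Y : S.carrier) :
    Pi0.mk (X ⊗ Y) = Pi0.mk X + Pi0.mk Y := rfl

theorem Pi0.mk_unit (S : SymCatGr.{u}) : Pi0.mk (𝟙_ S.carrier) = 0 := rfl

/-- A chosen representative of a connected component. -/
noncomputable def Pi0.out {S : SymCatGr.{u}} (x : Pi0 S) : S.carrier := Quotient.out x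

@[simp] theorem Pi0.mk_out {S : SymCatGr.{u}} (x : Pi0 S) : Pi0.mk x.out = x := Quotient.out_eq x

theorem Pi0.mk_eq_of_hom {S : SymCatGr.{u}} {X Y : S.carrier} (f : X ⟶ Y) :
    Pi0.mk X = Pi0.mk Y := Pi0.mk_eq_iff.2 ⟨asIso f⟩

/-- A degree function: the values in `π₁(S)` of the morphisms under a coherent identification of all
the automorphism groups of `S` with `π₁(S)`. It is additive for the composition, and faithful by
`deg_act`. For the tensor product it is additive only up to a correction `κ`, as the identification
is not compatible with the tensor product of objects; the last two fields normalize `κ`. -/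
structure DegreeFunction (S : SymCatGr.{u}) where
  deg : ∀ {X Y : S.carrier}, (X ⟶ Y) → Pi1 S
  κ : S.carrier → S.carrier → Pi1 S
  deg_comp : ∀ {X Y Z : S.carrier} (f : X ⟶ Y) (g : Y ⟶ Z), deg (f ≫ g) = deg f + deg g
  deg_act : ∀ (a : Aut (𝟙_ S.carrier)) (X : S.carrier), deg (act a X).hom = Pi1.mk a
  deg_tensorHom : ∀ {X Y Z W : S.carrier} (f : X ⟶ Y) (g : Z ⟶ W),
    deg (f ⊗ₘ g) = deg f + deg g + κ X Z - κ Y W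
  deg_leftUnitor : ∀ X : S.carrier, deg (λ_ X).hom = κ (𝟙_ S.carrier) X
  deg_rightUnitor : ∀ X : S.carrier, deg (ρ_ X).hom = κ X (𝟙_ S.carrier)

/-- A chosen isomorphism from an object to the representative of its component. -/
noncomputable def toOut {S : SymCatGr.{u}} (X : S.carrier) : X ≅ (Pi0.mk X).out :=
  (Pi0.mk_eq_iff.1 (Pi0.mk_out (Pi0.mk X)).symm).some

theorem exists_act {S : SymCatGr.{u}} {X Y : S.carrier} (f : X ⟶ Y) :
    ∃ a : Aut (𝟙_ S.carrier), f ≫ (toOut Y).hom = (act a X).hom ≫ (toOut X).hom ≫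
      eqToHom (congrArg Pi0.out (Pi0.mk_eq_of_hom f)) := by
  obtain ⟨a, ha⟩ := (act_bijective X).2 (asIso (f ≫ (toOut Y).hom ≫
      eqToHom (congrArg Pi0.out (Pi0.mk_eq_of_hom f).symm) ≫ (toOut X).inv))
  refine ⟨a, ?_⟩
  have : (act a X).hom = _ := congrArg Iso.hom ha
  rw [this]
  simp

/-- The degree of `f : X ⟶ Y` obtained by identifying `X` and `Y` with their common representative
through `toOut`. -/
noncomputable def rawDeg {S : SymCatGr.{u}} {X Y : S.carrier} (f : X ⟶ Y) : Pi1 S :=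
  Pi1.mk (exists_act f).choose

theorem rawDeg_eq {S : SymCatGr.{u}} {X Y : S.carrier} (f : X ⟶ Y) (a : Aut (𝟙_ S.carrier))
    (h : f ≫ (toOut Y).hom = (act a X).hom ≫ (toOut X).hom ≫
      eqToHom (congrArg Pi0.out (Pi0.mk_eq_of_hom f))) : rawDeg f = Pi1.mk a := by
  refine congrArg Pi1.mk (eq_of_act_hom X ?_)
  rw [(exists_act f).choose_spec] at h
  exact (cancel_mono _).1 h

theorem rawDeg_act {S : SymCatGr.{u}} (a : Aut (𝟙_ S.carrier)) (X : S.carrier) :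
    rawDeg (act a X).hom = Pi1.mk a := rawDeg_eq _ _ (by simp)

theorem rawDeg_comp {S : SymCatGr.{u}} {X Y Z : S.carrier} (f : X ⟶ Y) (g : Y ⟶ Z) :
    rawDeg (f ≫ g) = rawDeg f + rawDeg g := by
  obtain ⟨a, ha⟩ := exists_act f
  obtain ⟨b, hb⟩ := exists_act g
  rw [rawDeg_eq f a ha, rawDeg_eq g b hb, ← Pi1.mk_mul]
  refine rawDeg_eq _ _ ?_
  rw [Category.assoc, hb, ← Category.assoc, ← act_naturality, act_mul, Category.assoc,
    reassoc_of% ha]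
  simp

theorem rawDeg_id {S : SymCatGr.{u}} (X : S.carrier) : rawDeg (𝟙 X) = 0 := by
  simpa using rawDeg_comp (𝟙 X) (𝟙 X)

theorem rawDeg_eqToHom {S : SymCatGr.{u}} {X Y : S.carrier} (h : X = Y) :
    rawDeg (eqToHom h) = 0 := by
  subst h; exact rawDeg_id X

theorem rawDeg_tensorHom {S : SymCatGr.{u}} {X Y Z W : S.carrier} (f : X ⟶ Y) (g : Z ⟶ W) :
    rawDeg (f ⊗ₘ g) = rawDeg f + rawDeg g + rawDeg ((toOut X).hom ⊗ₘ (toOut Z).hom) -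
      rawDeg ((toOut Y).hom ⊗ₘ (toOut W).hom) := by
  obtain ⟨a, ha⟩ := exists_act f
  obtain ⟨b, hb⟩ := exists_act g
  have h : (f ⊗ₘ g) ≫ ((toOut Y).hom ⊗ₘ (toOut W).hom) =
      (act a (X ⊗ Z)).hom ≫ (act b (X ⊗ Z)).hom ≫ ((toOut X).hom ⊗ₘ (toOut Z).hom) ≫
        eqToHom (by rw [Pi0.mk_eq_of_hom f, Pi0.mk_eq_of_hom g]) := by
    rw [MonoidalCategory.tensorHom_comp_tensorHom, ha, hb,
      ← MonoidalCategory.tensorHom_comp_tensorHom, ← MonoidalCategory.tensorHom_comp_tensorHom,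
      MonoidalCategory.tensorHom_def (act a X).hom, act_whiskerRight, act_whiskerLeft,
      Category.assoc]
    congr 3
    have : ∀ {P Q R T : S.carrier} (h : P = Q) (h' : R = T), (eqToHom h ⊗ₘ eqToHom h') =
        eqToHom (by rw [h, h']) := by
      rintro P _ R _ rfl rfl
      simp
    exact this _ _
  have h' := congrArg rawDeg h
  rw [rawDeg_comp, rawDeg_comp, rawDeg_comp, rawDeg_comp, rawDeg_act, rawDeg_act,
    rawDeg_eqToHom, ← rawDeg_eq f a ha, ← rawDeg_eq g b hb] at h'
  rw [eq_sub_iff_add_eq, h']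
  abel

theorem rawDeg_leftUnitor_invariant {S : SymCatGr.{u}} {X Y : S.carrier} (f : X ⟶ Y) :
    rawDeg (λ_ X).hom - rawDeg ((toOut (𝟙_ S.carrier)).hom ⊗ₘ (toOut X).hom) =
      rawDeg (λ_ Y).hom - rawDeg ((toOut (𝟙_ S.carrier)).hom ⊗ₘ (toOut Y).hom) := by
  have h := congrArg rawDeg (leftUnitor_naturality f)
  rw [← id_tensorHom, rawDeg_comp, rawDeg_comp, rawDeg_tensorHom, rawDeg_id] at h
  grind

theorem rawDeg_rightUnitor_invariant {S : SymCatGr.{u}} {X Y : S.carrier} (f : X ⟶ Y) :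
    rawDeg (ρ_ X).hom - rawDeg ((toOut X).hom ⊗ₘ (toOut (𝟙_ S.carrier)).hom) =
      rawDeg (ρ_ Y).hom - rawDeg ((toOut Y).hom ⊗ₘ (toOut (𝟙_ S.carrier)).hom) := by
  have h := congrArg rawDeg (rightUnitor_naturality f)
  rw [← tensorHom_id, rawDeg_comp, rawDeg_comp, rawDeg_tensorHom, rawDeg_id] at h
  grind

/-- Degrees are taken with respect to the representatives, and `κ` records the degree of the tensor
product of the isomorphisms `toOut`; the unit constraints are then absorbed into `κ`. -/
theorem exists_degreeFunction (S : SymCatGr.{u}) : Nonempty (DegreeFunction S) := by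
  classical
  let κ : S.carrier → S.carrier → Pi1 S := fun X Y => rawDeg ((toOut X).hom ⊗ₘ (toOut Y).hom)
  -- `ν` only depends on the components, so that adding it to `κ` does not affect `deg_tensorHom`
  let ν : S.carrier → S.carrier → Pi1 S := fun X Y =>
    if Pi0.mk X = 0 then rawDeg (λ_ Y).hom - κ (𝟙_ _) Y
    else if Pi0.mk Y = 0 then rawDeg (ρ_ X).hom - κ X (𝟙_ _) else 0
  have hν : ∀ {X Y Z W : S.carrier} (f : X ⟶ Y) (g : Z ⟶ W), ν X Z = ν Y W := fun f g => by
    simp only [ν, Pi0.mk_eq_of_hom f, Pi0.mk_eq_of_hom g, κ, rawDeg_leftUnitor_invariant g,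
      rawDeg_rightUnitor_invariant f]
  refine ⟨⟨rawDeg, fun X Y => κ X Y + ν X Y, rawDeg_comp, rawDeg_act, fun f g => ?_, fun X => ?_,
    fun X => ?_⟩⟩
  · rw [rawDeg_tensorHom, hν f g]
    simp only [κ]
    abel
  · simp [ν, Pi0.mk_unit]
  · by_cases hX : Pi0.mk X = 0
    · obtain ⟨e⟩ := Pi0.mk_eq_iff.1 (hX.trans (Pi0.mk_unit S).symm)
      have h := rawDeg_rightUnitor_invariant e.hom
      simp only [ν, if_pos hX, κ, unitors_equal]
      grind
    · simp [ν, hX, Pi0.mk_unit]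

namespace DegreeFunction

variable {S : SymCatGr.{u}} (D : DegreeFunction S)

theorem deg_id (X : S.carrier) : D.deg (𝟙 X) = 0 := by
  simpa using D.deg_comp (𝟙 X) (𝟙 X)

theorem deg_eqToHom {X Y : S.carrier} (h : X = Y) : D.deg (eqToHom h) = 0 := by
  subst h; exact D.deg_id X

theorem deg_iso_inv {X Y : S.carrier} (e : X ≅ Y) : D.deg e.inv = -D.deg e.hom := by
  rw [eq_neg_iff_add_eq_zero, ← D.deg_comp, e.inv_hom_id, D.deg_id]

theorem deg_whiskerLeft (X : S.carrier) {Y Z : S.carrier} (f : Y ⟶ Z) :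
    D.deg (X ◁ f) = D.deg f + D.κ X Y - D.κ X Z := by
  rw [← id_tensorHom, D.deg_tensorHom, D.deg_id, zero_add]

theorem deg_whiskerRight {X Y : S.carrier} (f : X ⟶ Y) (Z : S.carrier) :
    D.deg (f ▷ Z) = D.deg f + D.κ X Z - D.κ Y Z := by
  rw [← tensorHom_id, D.deg_tensorHom, D.deg_id, add_zero]

theorem eq_act {X : S.carrier} (f : X ⟶ X) : f = (act (D.deg f).toAut X).hom := by
  obtain ⟨a, ha⟩ := (act_bijective X).2 (asIso f)
  have h : (act a X).hom = f := congrArg Iso.hom ha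
  rw [← h, D.deg_act]
  rfl

theorem deg_injective {X Y : S.carrier} {f g : X ⟶ Y} (h : D.deg f = D.deg g) : f = g := by
  rw [← cancel_mono (asIso g).inv, D.eq_act (f ≫ _), D.eq_act (g ≫ _), D.deg_comp, D.deg_comp, h]

theorem exists_deg_eq {X Y : S.carrier} (h : Pi0.mk X = Pi0.mk Y) (m : Pi1 S) :
    ∃ f : X ⟶ Y, D.deg f = m := by
  obtain ⟨e⟩ := Pi0.mk_eq_iff.1 h
  refine ⟨(act (m - D.deg e.hom).toAut X).hom ≫ e.hom, ?_⟩
  rw [D.deg_comp, D.deg_act]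
  exact sub_add_cancel _ _

/-- The isomorphism of a given degree between two objects of the same component. -/
noncomputable def homOfDeg {X Y : S.carrier} (h : Pi0.mk X = Pi0.mk Y) (m : Pi1 S) : X ≅ Y :=
  @asIso _ _ _ _ (D.exists_deg_eq h m).choose (IsGroupoid.all_isIso _)

@[simp] theorem deg_homOfDeg {X Y : S.carrier} (h : Pi0.mk X = Pi0.mk Y) (m : Pi1 S) :
    D.deg (D.homOfDeg h m).hom = m := (D.exists_deg_eq h m).choose_spec

/-- The degree of the associativity constraint, corrected by `κ` so as to depend only on the
components of the objects. -/
def assocDeg (X Y Z : S.carrier) : Pi1 S :=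
  D.deg (α_ X Y Z).hom - D.κ X Y - D.κ (X ⊗ Y) Z + D.κ Y Z + D.κ X (Y ⊗ Z)

/-- The degree of the commutativity constraint, corrected by `κ` so as to depend only on the
components of the objects. -/
def commDeg (X Y : S.carrier) : Pi1 S :=
  D.deg (β_ X Y).hom - D.κ X Y + D.κ Y X

theorem assocDeg_congr {X X' Y Y' Z Z' : S.carrier} (hX : Pi0.mk X = Pi0.mk X')
    (hY : Pi0.mk Y = Pi0.mk Y') (hZ : Pi0.mk Z = Pi0.mk Z') :
    D.assocDeg X Y Z = D.assocDeg X' Y' Z' := by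
  have h := congrArg D.deg (associator_naturality (D.homOfDeg hX 0).hom (D.homOfDeg hY 0).hom
    (D.homOfDeg hZ 0).hom)
  simp only [D.deg_comp, D.deg_tensorHom, deg_homOfDeg] at h
  simp only [assocDeg]
  grind

theorem commDeg_congr {X X' Y Y' : S.carrier} (hX : Pi0.mk X = Pi0.mk X')
    (hY : Pi0.mk Y = Pi0.mk Y') : D.commDeg X Y = D.commDeg X' Y' := by
  have h := congrArg D.deg (BraidedCategory.braiding_naturality (D.homOfDeg hX 0).hom
    (D.homOfDeg hY 0).hom)
  simp only [D.deg_comp, D.deg_tensorHom, deg_homOfDeg] at h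
  simp only [commDeg]
  grind

/-- The symmetric 3-cocycle on `π₀(S)` with values in `π₁(S)` formed by the constraints of `S`. -/
noncomputable def cocycle : SymCocycle (Pi0 S) (Pi1 S) where
  assoc x y z := D.assocDeg x.out y.out z.out
  comm x y := D.commDeg x.out y.out
  assoc_zero_mid x z := by
    rw [D.assocDeg_congr (Y := Pi0.out 0) (Y' := 𝟙_ _) rfl (by simp [Pi0.mk_unit]) rfl]
    have h := congrArg D.deg (triangle x.out z.out)
    simp only [D.deg_comp, D.deg_whiskerLeft, D.deg_whiskerRight, D.deg_leftUnitor,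
      D.deg_rightUnitor] at h
    simp only [assocDeg]
    grind
  pentagon w x y z := by
    rw [D.assocDeg_congr (X := w.out) (Y := (x + y).out) (Z := z.out) (Y' := x.out ⊗ y.out) rfl
        (by simp [Pi0.mk_tensor]) rfl,
      D.assocDeg_congr (X := (w + x).out) (X' := w.out ⊗ x.out) (by simp [Pi0.mk_tensor]) rfl rfl,
      D.assocDeg_congr (Z := (y + z).out) (Z' := y.out ⊗ z.out) rfl rfl
        (by simp [Pi0.mk_tensor])]
    have h := congrArg D.deg (MonoidalCategory.pentagon w.out x.out y.out z.out)
    simp only [D.deg_comp, D.deg_whiskerLeft, D.deg_whiskerRight] at h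
    simp only [assocDeg]
    grind
  hexagon x y z := by
    rw [D.commDeg_congr (Y := (y + z).out) (Y' := y.out ⊗ z.out) rfl (by simp [Pi0.mk_tensor])]
    have h := congrArg D.deg (BraidedCategory.hexagon_forward x.out y.out z.out)
    simp only [D.deg_comp, D.deg_whiskerLeft, D.deg_whiskerRight] at h
    simp only [assocDeg, commDeg]
    grind
  symm x y := by
    have h := congrArg D.deg (SymmetricCategory.symmetry x.out y.out)
    simp only [D.deg_comp, D.deg_id] at h
    simp only [commDeg]
    grind

theorem cocycle_assoc_mk (X Y Z : S.carrier) :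
    D.cocycle.assoc (Pi0.mk X) (Pi0.mk Y) (Pi0.mk Z) = D.assocDeg X Y Z :=
  D.assocDeg_congr (Pi0.mk_out _) (Pi0.mk_out _) (Pi0.mk_out _)

theorem cocycle_comm_mk (X Y : S.carrier) :
    D.cocycle.comm (Pi0.mk X) (Pi0.mk Y) = D.commDeg X Y :=
  D.commDeg_congr (Pi0.mk_out _) (Pi0.mk_out _)

theorem deg_associator (X Y Z : S.carrier) : D.deg (α_ X Y Z).hom =
    D.cocycle.assoc (Pi0.mk X) (Pi0.mk Y) (Pi0.mk Z) + D.κ X Y + D.κ (X ⊗ Y) Z - D.κ Y Z -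
      D.κ X (Y ⊗ Z) := by
  rw [cocycle_assoc_mk, assocDeg]
  abel

theorem deg_braiding (X Y : S.carrier) : D.deg (β_ X Y).hom =
    D.cocycle.comm (Pi0.mk X) (Pi0.mk Y) + D.κ X Y - D.κ Y X := by
  rw [cocycle_comm_mk, commDeg]
  abel

/-- On the diagonal the commutativity part of the cocycle is the invariant `k`. -/
theorem cocycle_comm_self (x : Pi0 S) : D.cocycle.comm x x = kInv S x := by
  induction x using Pi0.ind with | h X => ?_
  rw [cocycle_comm_mk, commDeg, ← act_selfBraiding, D.deg_act]
  exact sub_add_cancel _ _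

end DegreeFunction

end SymCatGr

/-! ### Existence of morphisms -/

namespace SymCocycle

variable {A B M N : Type*} [AddCommGroup A] [AddCommGroup B] [AddCommGroup M] [AddCommGroup N]

/-- The cocycle `f₁ ∘ c - d ∘ f₀`, whose class is the obstruction to realizing the pair `(f₀, f₁)`
by a morphism. -/
@[simps]
def difference (c : SymCocycle A M) (d : SymCocycle B N) (f₀ : A →+ B) (f₁ : M →+ N) :
    SymCocycle A N where
  assoc x y z := f₁ (c.assoc x y z) - d.assoc (f₀ x) (f₀ y) (f₀ z)
  comm x y := f₁ (c.comm x y) - d.comm (f₀ x) (f₀ y)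
  assoc_zero_mid x z := by simp [c.assoc_zero_mid, d.assoc_zero_mid]
  pentagon w x y z := by
    have h := congrArg f₁ (c.pentagon w x y z)
    have h' := d.pentagon (f₀ w) (f₀ x) (f₀ y) (f₀ z)
    simp only [map_add] at h ⊢
    grind
  hexagon x y z := by
    have h := congrArg f₁ (c.hexagon x y z)
    have h' := d.hexagon (f₀ x) (f₀ y) (f₀ z)
    simp only [map_add] at h ⊢
    grind
  symm x y := by
    have h := congrArg f₁ (c.symm x y)
    have h' := d.symm (f₀ x) (f₀ y)
    simp only [map_add, map_zero] at h
    grind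

end SymCocycle

namespace SymCatGr

open DegreeFunction

theorem pi0Map_mk {S T : SymCatGr.{u}} (F : S ⟶ T) (X : S.carrier) :
    pi0Map F (Pi0.mk X) = Pi0.mk ((fn F).obj X) := rfl

theorem DegreeFunction.deg_pi1Map {S T : SymCatGr.{u}} (E : DegreeFunction T) (F : S ⟶ T)
    (a : Pi1 S) : pi1Map F a = E.deg ((fn F).map a.toAut.hom) := by
  have h : pi1Map F a = E.deg (pi1Map F a).toAut.hom := by
    rw [← act_unit, E.deg_act]
    rfl
  rw [h]
  change E.deg ((Functor.Monoidal.εIso (fn F)).hom ≫ (fn F).map a.toAut.hom ≫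
    (Functor.Monoidal.εIso (fn F)).inv) = _
  rw [E.deg_comp, E.deg_comp, E.deg_iso_inv]
  abel

section Existence

variable {S T : SymCatGr.{u}} (D : DegreeFunction S) (E : DegreeFunction T)
  (f₀ : Pi0 S →+ Pi0 T) (f₁ : Pi1 S →+ Pi1 T)

/-- The functor that sends `X` to the representative of `f₀ [X]`, and a morphism of degree `m` to
the morphism of degree `f₁ m`. -/
@[simps obj]
noncomputable def realizeFunctor : S.carrier ⥤ T.carrier where
  obj X := (f₀ (Pi0.mk X)).out
  map f := (E.homOfDeg (by rw [Pi0.mk_eq_of_hom f]) (f₁ (D.deg f))).hom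
  map_id X := E.deg_injective (by rw [E.deg_homOfDeg, D.deg_id, map_zero, E.deg_id])
  map_comp f g := E.deg_injective (by simp [D.deg_comp, E.deg_comp])

theorem mk_realizeFunctor_obj (X : S.carrier) :
    Pi0.mk ((realizeFunctor D E f₀ f₁).obj X) = f₀ (Pi0.mk X) := Pi0.mk_out _

theorem deg_realizeFunctor_map {X Y : S.carrier} (f : X ⟶ Y) :
    E.deg ((realizeFunctor D E f₀ f₁).map f) = f₁ (D.deg f) :=
  E.deg_homOfDeg (by simp only [mk_realizeFunctor_obj, Pi0.mk_eq_of_hom f]) _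

variable {f₀ f₁} {γ : Pi0 S → Pi0 S → Pi1 T} (hγ : SymCocycle.IsNormalized γ)
  (hassoc : ∀ x y z, f₁ (D.cocycle.assoc x y z) = E.cocycle.assoc (f₀ x) (f₀ y) (f₀ z) +
    (γ x y + γ (x + y) z - γ y z - γ x (y + z)))
  (hcomm : ∀ x y, f₁ (D.cocycle.comm x y) = E.cocycle.comm (f₀ x) (f₀ y) + (γ x y - γ y x))

/-- A cochain `γ` with `∂γ = f₁ ∘ c_S - c_T ∘ f₀` makes `realizeFunctor` a monoidal functor: the
tensorator has degree `-γ`, up to the corrections `κ`. -/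
noncomputable def realizeCore : (realizeFunctor D E f₀ f₁).CoreMonoidal where
  εIso := E.homOfDeg (by rw [mk_realizeFunctor_obj, Pi0.mk_unit, Pi0.mk_unit, map_zero]) 0
  μIso X Y := E.homOfDeg
    (by simp only [mk_realizeFunctor_obj, Pi0.mk_tensor, map_add])
    (E.κ ((realizeFunctor D E f₀ f₁).obj X) ((realizeFunctor D E f₀ f₁).obj Y) -
      f₁ (D.κ X Y) - γ (Pi0.mk X) (Pi0.mk Y))
  μIso_hom_natural_left f Z := E.deg_injective (by
    simp only [E.deg_comp, E.deg_whiskerRight, D.deg_whiskerRight, deg_realizeFunctor_map,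
      deg_homOfDeg, map_add, map_sub, Pi0.mk_eq_of_hom f]
    abel)
  μIso_hom_natural_right Z f := E.deg_injective (by
    simp only [E.deg_comp, E.deg_whiskerLeft, D.deg_whiskerLeft, deg_realizeFunctor_map,
      deg_homOfDeg, map_add, map_sub, Pi0.mk_eq_of_hom f]
    abel)
  associativity X Y Z := E.deg_injective (by
    simp only [E.deg_comp, E.deg_whiskerLeft, E.deg_whiskerRight, deg_realizeFunctor_map,
      deg_homOfDeg, E.deg_associator, D.deg_associator, map_add, map_sub, hassoc,
      mk_realizeFunctor_obj, Pi0.mk_tensor]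
    abel)
  left_unitality X := E.deg_injective (by
    simp only [E.deg_comp, E.deg_whiskerRight, deg_realizeFunctor_map, deg_homOfDeg,
      E.deg_leftUnitor, D.deg_leftUnitor, Pi0.mk_unit, hγ.zero_left]
    abel)
  right_unitality X := E.deg_injective (by
    simp only [E.deg_comp, E.deg_whiskerLeft, deg_realizeFunctor_map, deg_homOfDeg,
      E.deg_rightUnitor, D.deg_rightUnitor, Pi0.mk_unit, hγ.zero_right]
    abel)

/-- The morphism of symmetric categorical groups with underlying functor `realizeFunctor`. -/
noncomputable def realize : S ⟶ T :=
  letI := (realizeCore D E hγ hassoc).toMonoidal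
  Morphism.mk (realizeFunctor D E f₀ f₁) (braided :=
    { braided := fun X Y => E.deg_injective (by
        change E.deg (((realizeCore D E hγ hassoc).μIso X Y).hom ≫ _) =
          E.deg (_ ≫ ((realizeCore D E hγ hassoc).μIso Y X).hom)
        simp only [realizeCore, E.deg_comp, deg_realizeFunctor_map, deg_homOfDeg, E.deg_braiding,
          D.deg_braiding, map_add, map_sub, hcomm, mk_realizeFunctor_obj]
        abel) })

theorem pi0Map_realize : pi0Map (realize D E hγ hassoc hcomm) = f₀ := by
  ext x
  induction x using Pi0.ind with | h X => ?_
  exact mk_realizeFunctor_obj D E f₀ f₁ X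

theorem pi1Map_realize : pi1Map (realize D E hγ hassoc hcomm) = f₁ := by
  ext a
  rw [E.deg_pi1Map]
  refine (deg_realizeFunctor_map D E f₀ f₁ a.toAut.hom).trans (congrArg f₁ ?_)
  rw [← act_unit, D.deg_act]
  rfl

end Existence

/-- Every morphism of types `type(S) → type(T)` is realized if `π₀(S)` is free or `π₁(T)` is
divisible: the obstruction is the difference of two cocycles with the same diagonal. -/
theorem exists_morphism {S T : SymCatGr.{u}}
    (hST : Module.Free ℤ (Pi0 S) ∨ IsDivisible (Pi1 T))
    (f₀ : Pi0 S →+ Pi0 T) (f₁ : Pi1 S →+ Pi1 T) (hf : (kInv T).comp f₀ = f₁.comp (kInv S)) :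
    ∃ F : S ⟶ T, pi0Map F = f₀ ∧ pi1Map F = f₁ := by
  obtain ⟨D⟩ := exists_degreeFunction S
  obtain ⟨E⟩ := exists_degreeFunction T
  have halt : ∀ x, (D.cocycle.difference E.cocycle f₀ f₁).comm x x = 0 := fun x => by
    rw [SymCocycle.difference_comm, cocycle_comm_self, cocycle_comm_self]
    exact sub_eq_zero.2 (DFunLike.congr_fun hf x).symm
  obtain ⟨γ, hγ, h⟩ : (D.cocycle.difference E.cocycle f₀ f₁).Trivializable := by
    rcases hST with hS | hT
    · exact SymCocycle.trivializable_of_free _ halt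
    · exact SymCocycle.trivializable_of_isDivisible hT _ halt
  have hassoc : ∀ x y z, f₁ (D.cocycle.assoc x y z) = E.cocycle.assoc (f₀ x) (f₀ y) (f₀ z) +
      (γ x y + γ (x + y) z - γ y z - γ x (y + z)) := fun x y z => by
    have := h.assoc_eq (Set.mem_univ x) (Set.mem_univ y) (Set.mem_univ z)
    simp only [SymCocycle.subCoboundary_assoc, SymCocycle.difference_assoc] at this
    grind
  have hcomm : ∀ x y, f₁ (D.cocycle.comm x y) = E.cocycle.comm (f₀ x) (f₀ y) +
      (γ x y - γ y x) := fun x y => by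
    have := h.comm_eq (Set.mem_univ x) (Set.mem_univ y)
    simp only [SymCocycle.subCoboundary_comm, SymCocycle.difference_comm] at this
    grind
  exact ⟨realize D E hγ hassoc hcomm, pi0Map_realize D E hγ hassoc hcomm,
    pi1Map_realize D E hγ hassoc hcomm⟩

/-! ### Uniqueness of morphisms -/

section Uniqueness

variable {S T : SymCatGr.{u}} (D : DegreeFunction S) (E : DegreeFunction T)

theorem deg_map_act (F : S ⟶ T) (a : Aut (𝟙_ S.carrier)) (X : S.carrier) :
    E.deg ((fn F).map (act a X).hom) = pi1Map F (Pi1.mk a) := by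
  have h := congrArg E.deg (Functor.LaxMonoidal.μ_natural_left (fn F) a.hom X)
  have h' := E.deg_comp ((fn F).map (λ_ X).inv) ((fn F).map (λ_ X).hom)
  rw [E.deg_comp, E.deg_comp, E.deg_whiskerRight] at h
  rw [← Functor.map_comp, Iso.inv_hom_id, CategoryTheory.Functor.map_id, E.deg_id] at h'
  rw [E.deg_pi1Map, act_hom, Functor.map_comp, Functor.map_comp, E.deg_comp, E.deg_comp]
  change _ = E.deg ((fn F).map a.hom)
  grind

/-- A morphism acts on degrees by `π₁(F)`, up to a change `p` of the identifications of the
automorphism groups. -/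
theorem exists_deg_map (F : S ⟶ T) : ∃ p : S.carrier → Pi1 T, ∀ {X Y : S.carrier} (f : X ⟶ Y),
    E.deg ((fn F).map f) = pi1Map F (D.deg f) + p X - p Y := by
  let v : ∀ X : S.carrier, X ≅ (Pi0.mk X).out := fun X => D.homOfDeg (Pi0.mk_out _).symm 0
  have hv : ∀ X, D.deg (v X).hom = 0 := fun X => D.deg_homOfDeg _ _
  refine ⟨fun X => E.deg ((fn F).map (v X).hom), fun {X Y} f => ?_⟩
  have h : f ≫ (v Y).hom = (act (D.deg f).toAut X).hom ≫ (v X).hom ≫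
      eqToHom (congrArg Pi0.out (Pi0.mk_eq_of_hom f)) := D.deg_injective (by
    rw [D.deg_comp, D.deg_comp, D.deg_comp, D.deg_act, D.deg_eqToHom, hv, hv]
    exact (add_zero _).trans ((congrArg _ (add_zero 0)).trans (add_zero _)).symm)
  have h' := congrArg (fun f => E.deg ((fn F).map f)) h
  simp only [Functor.map_comp, E.deg_comp, eqToHom_map, E.deg_eqToHom, deg_map_act] at h'
  rw [eq_sub_iff_add_eq, h', add_zero]
  rfl

/-- The data of a morphism `F` in terms of degrees: `p` compares the identifications of the
automorphism groups on both sides, and `g` is the degree of the tensorator, corrected so as to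
depend only on the components of the objects. -/
structure MorphismCochain (F : S ⟶ T) where
  p : S.carrier → Pi1 T
  g : Pi0 S → Pi0 S → Pi1 T
  deg_map : ∀ {X Y : S.carrier} (f : X ⟶ Y),
    E.deg ((fn F).map f) = pi1Map F (D.deg f) + p X - p Y
  deg_μ : ∀ X Y : S.carrier, E.deg (Functor.LaxMonoidal.μ (fn F) X Y) =
    g (Pi0.mk X) (Pi0.mk Y) + E.κ ((fn F).obj X) ((fn F).obj Y) - pi1Map F (D.κ X Y) -
      p (X ⊗ Y) + p X + p Y

theorem exists_morphismCochain (F : S ⟶ T) : Nonempty (MorphismCochain D E F) := by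
  obtain ⟨p, hp⟩ := exists_deg_map D E F
  let G : S.carrier → S.carrier → Pi1 T := fun X Y => E.deg (Functor.LaxMonoidal.μ (fn F) X Y) -
    E.κ ((fn F).obj X) ((fn F).obj Y) + pi1Map F (D.κ X Y) + p (X ⊗ Y) - p X - p Y
  have hG : ∀ {X X' Y Y' : S.carrier}, Pi0.mk X = Pi0.mk X' → Pi0.mk Y = Pi0.mk Y' →
      G X Y = G X' Y' := fun {X X' Y Y'} hX hY => by
    have h := congrArg E.deg (Functor.LaxMonoidal.μ_natural (fn F) (D.homOfDeg hX 0).hom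
      (D.homOfDeg hY 0).hom)
    simp only [E.deg_comp, E.deg_tensorHom, hp, D.deg_tensorHom, deg_homOfDeg, map_add, map_sub,
      map_zero] at h
    simp only [G]
    grind
  refine ⟨⟨p, fun x y => G x.out y.out, hp, fun X Y => ?_⟩⟩
  rw [hG (Pi0.mk_out _) (Pi0.mk_out _)]
  simp only [G]
  abel

namespace MorphismCochain

variable {D E} {F G : S ⟶ T}

theorem assoc (c : MorphismCochain D E F) (x y z : Pi0 S) :
    c.g x y + c.g (x + y) z + pi1Map F (D.cocycle.assoc x y z) =
      E.cocycle.assoc (pi0Map F x) (pi0Map F y) (pi0Map F z) + c.g y z + c.g x (y + z) := by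
  induction x using Pi0.ind with | h X => ?_
  induction y using Pi0.ind with | h Y => ?_
  induction z using Pi0.ind with | h Z => ?_
  have h := congrArg E.deg (Functor.LaxMonoidal.associativity (fn F) X Y Z)
  simp only [E.deg_comp, E.deg_whiskerLeft, E.deg_whiskerRight, c.deg_map, c.deg_μ,
    D.deg_associator, E.deg_associator, map_add, map_sub, Pi0.mk_tensor] at h
  simp only [pi0Map_mk]
  grind

theorem comm (c : MorphismCochain D E F) (x y : Pi0 S) :
    c.g x y + pi1Map F (D.cocycle.comm x y) =
      E.cocycle.comm (pi0Map F x) (pi0Map F y) + c.g y x := by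
  induction x using Pi0.ind with | h X => ?_
  induction y using Pi0.ind with | h Y => ?_
  have h := congrArg E.deg (Functor.LaxBraided.braided (F := fn F) X Y)
  simp only [E.deg_comp, c.deg_map, c.deg_μ, D.deg_braiding, E.deg_braiding, map_add, map_sub] at h
  simp only [pi0Map_mk]
  grind

theorem deg_ε (c : MorphismCochain D E F) :
    E.deg (Functor.LaxMonoidal.ε (fn F)) = -c.g 0 0 - c.p (𝟙_ S.carrier) := by
  have h := congrArg E.deg (Functor.LaxMonoidal.left_unitality (fn F) (𝟙_ S.carrier))
  simp only [E.deg_comp, E.deg_whiskerRight, c.deg_map, c.deg_μ, D.deg_leftUnitor,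
    E.deg_leftUnitor, Pi0.mk_unit] at h
  grind

/-- For two morphisms that agree on `π₀` and on `π₁`, the difference of the 2-cochains is a
symmetric 2-cocycle, and a trivialization of it is a track. -/
theorem nonempty_iso (c : MorphismCochain D E F) (d : MorphismCochain D E G)
    (hsplit : SplitsTwoCocycles (Pi0 S) (Pi1 T)) (h₀ : pi0Map F = pi0Map G)
    (h₁ : pi1Map F = pi1Map G) : Nonempty (F ≅ G) := by
  obtain ⟨φ, hφ⟩ := hsplit (fun x y => c.g x y - d.g x y) ⟨fun x y z => by
      have hc := c.assoc x y z
      have hd := d.assoc x y z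
      rw [h₀, h₁] at hc
      grind, fun x y => by
      have hc := c.comm x y
      have hd := d.comm x y
      rw [h₀, h₁] at hc
      grind⟩
  let τ : ∀ X, (fn F).obj X ≅ (fn G).obj X := fun X => E.homOfDeg
    (DFunLike.congr_fun h₀ (Pi0.mk X)) (c.p X - d.p X + φ (Pi0.mk X))
  have hτ : ∀ X, E.deg (τ X).hom = c.p X - d.p X + φ (Pi0.mk X) := fun X => E.deg_homOfDeg _ _
  let e : fn F ≅ fn G := NatIso.ofComponents τ fun f => E.deg_injective (by
    simp only [E.deg_comp, c.deg_map, d.deg_map, hτ, h₁, Pi0.mk_eq_of_hom f]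
    abel)
  have he : ∀ X, e.hom.app X = (τ X).hom := fun _ => rfl
  have : NatTrans.IsMonoidal e.hom :=
    { unit := E.deg_injective (by
        have := hφ 0 0
        rw [add_zero] at this
        rw [he, E.deg_comp, c.deg_ε, d.deg_ε, hτ, Pi0.mk_unit]
        grind)
      tensor := fun X Y => E.deg_injective (by
        have := hφ (Pi0.mk X) (Pi0.mk Y)
        rw [he, he, he, E.deg_comp, E.deg_comp, c.deg_μ, d.deg_μ, E.deg_tensorHom, hτ, hτ, hτ, h₁,
          Pi0.mk_tensor]
        grind) }
  exact ⟨trackIso e⟩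

end MorphismCochain

/-- Morphisms `S ⟶ T` are determined up to a track by their values on `π₀` and `π₁` if `π₀(S)` is
free or `π₁(T)` is divisible. -/
theorem nonempty_iso_of_pi_eq (hST : Module.Free ℤ (Pi0 S) ∨ IsDivisible (Pi1 T)) {F G : S ⟶ T}
    (h₀ : pi0Map F = pi0Map G) (h₁ : pi1Map F = pi1Map G) : Nonempty (F ≅ G) := by
  obtain ⟨D⟩ := exists_degreeFunction S
  obtain ⟨E⟩ := exists_degreeFunction T
  obtain ⟨c⟩ := exists_morphismCochain D E F
  obtain ⟨d⟩ := exists_morphismCochain D E G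
  refine c.nonempty_iso d ?_ h₀ h₁
  rcases hST with hS | hT
  · exact splitsTwoCocycles_of_projective _ _
  · exact hT.splitsTwoCocycles _

end Uniqueness

end SymCatGr

/-! ### Symmetric categorical groups of type `l(P)` and `r(Q)` -/

namespace SymCocycle

variable {A M : Type u} [AddCommGroup A] [AddCommGroup M]

/-- A biadditive map `b` with `b x y + b y x = 0` is a symmetric 3-cocycle with trivial
associativity part: the skeletal symmetric categorical group it defines is strictly associative. -/
@[simps]
def ofBilinear (b : A →+ A →+ M) (hb : ∀ x y, b x y + b y x = 0) : SymCocycle A M where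
  assoc _ _ _ := 0
  comm x y := b x y
  assoc_zero_mid _ _ := rfl
  pentagon _ _ _ _ := by simp
  hexagon _ _ _ := by simp
  symm := hb

/-- The skeletal symmetric categorical group of a cocycle, with `π₀ = A` and `π₁ = M`. -/
abbrev toSymCatGr (c : SymCocycle A M) : SymCatGr.{u} where
  carrier := c.Obj
  exists_inverse X := ⟨⟨-X.el⟩, ⟨mkIso (add_neg_cancel X.el) 0⟩⟩

variable (c : SymCocycle A M)

/-- The group `π₀` of the skeletal symmetric categorical group of a cocycle on `A`. -/
def pi0Equiv : SymCatGr.Pi0 c.toSymCatGr ≃+ A where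
  toFun := SymCatGr.Pi0.lift (fun X : c.Obj => X.el) fun _ _ e => el_eq (c := c) e.hom
  invFun a := SymCatGr.Pi0.mk (S := c.toSymCatGr) (⟨a⟩ : c.Obj)
  left_inv x := by induction x using SymCatGr.Pi0.ind with | h X => rfl
  right_inv _ := rfl
  map_add' x y := by
    induction x using SymCatGr.Pi0.ind with | h X => ?_
    induction y using SymCatGr.Pi0.ind with | h Y => ?_
    rfl

/-- The group `π₁` of the skeletal symmetric categorical group of a cocycle with values in `M`. -/
def pi1Equiv : SymCatGr.Pi1 c.toSymCatGr ≃+ M where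
  toFun a := val (c := c) (SymCatGr.Pi1.toAut a).hom
  invFun m := SymCatGr.Pi1.mk (S := c.toSymCatGr) (mkIso (c := c) rfl m)
  left_inv _ := Iso.ext (hom_ext (c := c) rfl)
  right_inv _ := rfl
  map_add' a b := by
    change val (c := c) ((SymCatGr.Pi1.toAut b).hom ≫ (SymCatGr.Pi1.toAut a).hom) = _
    rw [val_comp, add_comm]

theorem val_conj_leftUnitor {c : SymCocycle A M} (f : 𝟙_ c.Obj ⟶ 𝟙_ c.Obj) (X : c.Obj) :
    val ((λ_ X).inv ≫ f ▷ X ≫ (λ_ X).hom) = val f := by simp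

theorem pi1Equiv_kInv (x : SymCatGr.Pi0 c.toSymCatGr) :
    c.pi1Equiv (SymCatGr.kInv _ x) = c.comm (c.pi0Equiv x) (c.pi0Equiv x) := by
  induction x using SymCatGr.Pi0.ind with | h X => ?_
  have h : val (c := c) (SymCatGr.act (SymCatGr.selfBraiding X) (X ⊗ X)).hom =
      val (c := c) (β_ (X : c.Obj) (X : c.Obj)).hom := by
    rw [SymCatGr.act_selfBraiding]
  exact (val_conj_leftUnitor (c := c) _ _).symm.trans h

end SymCocycle

/-- An isomorphism of types from a pair of compatible isomorphisms of groups. -/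
def GrType.isoMk {A B : GrType.{u}} (e₀ : A.zero ≃+ B.zero) (e₁ : A.one ≃+ B.one)
    (h : ∀ x, B.k (e₀ x) = e₁ (A.k x)) : A ≅ B where
  hom := (⟨e₀, e₁, AddMonoidHom.ext h⟩ : GrType.Hom A B)
  inv := (⟨e₀.symm, e₁.symm, AddMonoidHom.ext fun x => e₁.injective (by
    change e₁ (A.k (e₀.symm x)) = e₁ (e₁.symm (B.k x))
    rw [← h]
    simp)⟩ : GrType.Hom B A)
  hom_inv_id := GrType.Hom.ext (AddMonoidHom.ext e₀.symm_apply_apply)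
    (AddMonoidHom.ext e₁.symm_apply_apply)
  inv_hom_id := GrType.Hom.ext (AddMonoidHom.ext e₀.apply_symm_apply)
    (AddMonoidHom.ext e₁.apply_symm_apply)

theorem GrType.exists_equiv_of_iso {A B : GrType.{u}} (e : A ≅ B) :
    ∃ (e₀ : A.zero ≃+ B.zero) (e₁ : A.one ≃+ B.one), ∀ x, B.k (e₀ x) = e₁ (A.k x) :=
  ⟨AddMonoidHom.toAddEquiv (Hom.zero e.hom) (Hom.zero e.inv) (congrArg Hom.zero e.hom_inv_id)
      (congrArg Hom.zero e.inv_hom_id),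
    AddMonoidHom.toAddEquiv (Hom.one e.hom) (Hom.one e.inv) (congrArg Hom.one e.hom_inv_id)
      (congrArg Hom.one e.inv_hom_id), DFunLike.congr_fun (Hom.comm e.hom)⟩

namespace SymCatGr

/-- A type is realized as soon as its homomorphism `k` is the diagonal `x ↦ b x x` of an
antisymmetric biadditive map `b`, which then serves as the braiding. -/
theorem exists_type_iso (A : GrType.{u}) (b : A.zero →+ A.zero →+ A.one)
    (hb : ∀ x y, b x y + b y x = 0) (hk : ∀ x, b x x = A.k x) :
    ∃ T : SymCatGr.{u}, Nonempty (T.type ≅ A) :=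
  ⟨(SymCocycle.ofBilinear b hb).toSymCatGr, ⟨GrType.isoMk (A := type _)
    (SymCocycle.pi0Equiv _) (SymCocycle.pi1Equiv _) fun x => by
      refine Eq.trans ?_ (SymCocycle.pi1Equiv_kInv _ x).symm
      exact (hk _).symm⟩⟩

/-- The braiding is `(x, y) ↦ xy mod 2`, where the product of `I →₀ ℤ` is taken coordinatewise:
on the diagonal, `x² ≡ x mod 2`. -/
theorem exists_type_iso_l (I : Type u) :
    ∃ T : SymCatGr.{u}, Nonempty (T.type ≅ GrType.l (I →₀ ℤ)) := by
  have h2 : ∀ y : I →₀ ℤ, (QuotientAddGroup.mk' (GrType.twoMul (I →₀ ℤ))) (2 • y) = 0 := fun y =>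
    (QuotientAddGroup.eq_zero_iff _).2 ⟨y, rfl⟩
  refine exists_type_iso (GrType.l (I →₀ ℤ))
    ((AddMonoidHom.compHom (QuotientAddGroup.mk' (GrType.twoMul (I →₀ ℤ)))).comp
      (AddMonoidHom.mul (R := I →₀ ℤ))) (fun (x y : I →₀ ℤ) => ?_) fun (x : I →₀ ℤ) => ?_
  · change QuotientAddGroup.mk' (GrType.twoMul (I →₀ ℤ)) (x * y) +
      QuotientAddGroup.mk' (GrType.twoMul (I →₀ ℤ)) (y * x) = 0
    rw [mul_comm y x, ← two_nsmul, ← map_nsmul, h2]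
  · change QuotientAddGroup.mk' (GrType.twoMul (I →₀ ℤ)) (x * x) =
      QuotientAddGroup.mk' (GrType.twoMul (I →₀ ℤ)) x
    rw [← sub_eq_zero, ← map_sub]
    have : x * x - x = 2 • Finsupp.mapRange (fun n : ℤ => n * (n - 1) / 2) (by simp) x := by
      ext i
      have : 2 ∣ x i * (x i - 1) := (Int.even_mul_pred_self (x i)).two_dvd
      simp only [Finsupp.sub_apply, Finsupp.mul_apply, Finsupp.smul_apply, Finsupp.mapRange_apply,
        nsmul_eq_mul, Nat.cast_ofNat, Int.mul_ediv_cancel' this]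
      ring
    rw [this, h2]

/-- The braiding is the coordinatewise product with respect to a basis of the vector space `₂Q` over
the field with two elements, in which every element is its own square. -/
theorem exists_type_iso_r (Q : Type u) [AddCommGroup Q] :
    ∃ T : SymCatGr.{u}, Nonempty (T.type ≅ GrType.r Q) := by
  let _ : Module (ZMod 2) (GrType.twoTorsion Q) :=
    AddCommGroup.zmodModule fun x => Subtype.ext x.2
  let e := (Module.Free.chooseBasis (ZMod 2) (GrType.twoTorsion Q)).repr.toAddEquiv
  let b : GrType.twoTorsion Q →+ GrType.twoTorsion Q →+ Q :=
    AddMonoidHom.mk' (fun x => AddMonoidHom.mk' (fun y => (e.symm (e x * e y) : Q))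
      fun y z => by simp [mul_add]) fun x y => by ext z; simp [add_mul]
  have hb : ∀ x y, b x y = (e.symm (e x * e y) : Q) := fun _ _ => rfl
  have hsymm : ∀ x y, b x y + b y x = 0 := fun x y => by
    rw [hb, hb, mul_comm (e y), ← two_nsmul]
    exact (e.symm (e x * e y)).2
  have hself : ∀ x, b x x = x := fun x => by
    have : e x * e x = e x := by
      ext i
      rw [Finsupp.mul_apply]
      generalize e x i = n
      revert n
      decide
    rw [hb, this, AddEquiv.symm_apply_apply]
  exact exists_type_iso (GrType.r Q) b hsymm hself

/-! ### Projective objects -/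

/-- Every morphism `F` of symmetric categorical groups induces a morphism of types. -/
theorem kInv_naturality {S T : SymCatGr.{u}} (F : S ⟶ T) (x : Pi0 S) :
    kInv T (pi0Map F x) = pi1Map F (kInv S x) := by
  obtain ⟨D⟩ := exists_degreeFunction S
  obtain ⟨E⟩ := exists_degreeFunction T
  obtain ⟨c⟩ := exists_morphismCochain D E F
  have h := c.comm x x
  rw [DegreeFunction.cocycle_comm_self, DegreeFunction.cocycle_comm_self, add_comm] at h
  exact (add_right_cancel h).symm

theorem pi0Map_comp {R S T : SymCatGr.{u}} (F : R ⟶ S) (G : S ⟶ T) :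
    pi0Map (F ≫ G) = (pi0Map G).comp (pi0Map F) := by
  ext x
  induction x using Pi0.ind with | h X => rfl

theorem pi1Map_comp {R S T : SymCatGr.{u}} (F : R ⟶ S) (G : S ⟶ T) :
    pi1Map (F ≫ G) = (pi1Map G).comp (pi1Map F) := by
  obtain ⟨E⟩ := exists_degreeFunction T
  ext a
  rw [AddMonoidHom.comp_apply, E.deg_pi1Map, E.deg_pi1Map G]
  change E.deg ((fn G).map ((fn F).map a.toAut.hom)) =
    E.deg ((fn G).map ((Functor.Monoidal.εIso (fn F)).hom ≫ (fn F).map a.toAut.hom ≫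
      (Functor.Monoidal.εIso (fn F)).inv))
  have h := E.deg_iso_inv ((fn G).mapIso (Functor.Monoidal.εIso (fn F)))
  rw [Functor.mapIso_inv, Functor.mapIso_hom] at h
  rw [Functor.map_comp, Functor.map_comp, E.deg_comp, E.deg_comp, h]
  abel

/-- `type(T)` is isomorphic to `l(P)` for some free abelian group `P`, stated in terms of
`k : π₀(T) → π₁(T)`: the group `π₀(T)` is free, and `k` is onto with kernel `2 π₀(T)`. -/
structure HasFreeType (T : SymCatGr.{u}) : Prop where
  free : Module.Free ℤ (Pi0 T)
  surjective : Function.Surjective (kInv T)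
  exists_two_nsmul : ∀ x, kInv T x = 0 → ∃ y, x = 2 • y

theorem hasFreeType_of_iso_l {P : Type u} [AddCommGroup P] [Module.Free ℤ P]
    {T : SymCatGr.{u}} (e : T.type ≅ GrType.l P) : HasFreeType T := by
  obtain ⟨e₀, e₁, he⟩ := GrType.exists_equiv_of_iso e
  change Pi0 T ≃+ P at e₀
  refine ⟨Module.Free.of_equiv e₀.symm.toIntLinearEquiv, fun m => ?_, fun x hx => ?_⟩
  · obtain ⟨x, hx⟩ := QuotientAddGroup.mk'_surjective _ (e₁ m)
    refine ⟨e₀.symm x, e₁.injective ((he _).symm.trans ?_)⟩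
    change QuotientAddGroup.mk' _ (e₀ (e₀.symm x)) = _
    rw [e₀.apply_symm_apply, hx]
  · have h1 : QuotientAddGroup.mk' (GrType.twoMul P) (e₀ x) = 0 :=
      (he x).trans ((congrArg e₁ hx).trans (map_zero e₁))
    obtain ⟨y, hy⟩ := (QuotientAddGroup.eq_zero_iff _).1 h1
    exact ⟨e₀.symm y, e₀.injective (by rw [map_nsmul, e₀.apply_symm_apply]; exact hy.symm)⟩

/-- Since `k` identifies `π₁(T)` with `π₀(T) / 2 π₀(T)`, a homomorphism on `π₀` determines the one
on `π₁`. -/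
theorem HasFreeType.exists_pi0Map_eq {T : SymCatGr.{u}} (hT : HasFreeType T) {S : SymCatGr.{u}}
    (f₀ : Pi0 T →+ Pi0 S) : ∃ F : T ⟶ S, pi0Map F = f₀ := by
  have hker : (kInv T).ker ≤ ((kInv S).comp f₀).ker := fun x hx => by
    obtain ⟨y, rfl⟩ := hT.exists_two_nsmul x hx
    rw [AddMonoidHom.mem_ker, AddMonoidHom.comp_apply, map_nsmul, map_nsmul, two_nsmul_kInv]
  obtain ⟨F, hF, -⟩ := exists_morphism (Or.inl hT.free) f₀
    ((kInv T).liftOfSurjective hT.surjective ⟨(kInv S).comp f₀, hker⟩)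
    (AddMonoidHom.ext fun x => ((kInv T).liftOfRightInverse_comp_apply _
      (Function.rightInverse_surjInv hT.surjective) ⟨(kInv S).comp f₀, hker⟩ x).symm)
  exact ⟨F, hF⟩

theorem HasFreeType.isProjective {T : SymCatGr.{u}} (hT : HasFreeType T) : T.IsProjective := by
  intro S₁ S₂ F hF G
  have := hT.free
  obtain ⟨f₀, hf₀⟩ := Module.projective_lifting_property (pi0Map F).toIntLinearMap
    (pi0Map G).toIntLinearMap hF
  obtain ⟨L, hL⟩ := hT.exists_pi0Map_eq f₀.toAddMonoidHom
  have h₀ : pi0Map (L ≫ F) = pi0Map G := by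
    rw [pi0Map_comp, hL]
    ext x
    exact LinearMap.congr_fun hf₀ x
  refine ⟨L, nonempty_iso_of_pi_eq (Or.inl hT.free) h₀ ?_⟩
  ext m
  obtain ⟨x, rfl⟩ := hT.surjective m
  rw [← kInv_naturality, ← kInv_naturality, h₀]

/-! ### Injective objects -/

/-- `type(T)` is isomorphic to `r(Q)` for some divisible abelian group `Q`, stated in terms of
`k : π₀(T) → π₁(T)`: the group `π₁(T)` is divisible, and `k` is injective with image `₂π₁(T)`. -/
structure HasDivisibleType (T : SymCatGr.{u}) : Prop where
  divisible : IsDivisible (Pi1 T)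
  injective : Function.Injective (kInv T)
  exists_kInv_eq : ∀ m, 2 • m = 0 → ∃ x, kInv T x = m

theorem hasDivisibleType_of_iso_r {Q : Type u} [AddCommGroup Q] (hQ : IsDivisible Q)
    {T : SymCatGr.{u}} (e : T.type ≅ GrType.r Q) : HasDivisibleType T := by
  obtain ⟨e₀, e₁, he⟩ := GrType.exists_equiv_of_iso e
  change Pi1 T ≃+ Q at e₁
  refine ⟨fun n hn m => ?_, fun x y hxy => ?_, fun m hm => ?_⟩
  · obtain ⟨q, hq⟩ := hQ n hn (e₁ m)
    exact ⟨e₁.symm q, by rw [← map_nsmul, hq, e₁.symm_apply_apply]⟩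
  · exact e₀.injective (Subtype.ext ((he x).trans ((congrArg e₁ hxy).trans (he y).symm)))
  · have h2 : 2 • e₁ m = 0 := by rw [← map_nsmul, hm, map_zero]
    refine ⟨e₀.symm (⟨e₁ m, h2⟩ : GrType.twoTorsion Q), e₁.injective ((he _).symm.trans ?_)⟩
    exact congrArg (GrType.r Q).k (e₀.apply_symm_apply _)

/-- Since `k` identifies `π₀(T)` with `₂π₁(T)`, a homomorphism on `π₁` determines the one on `π₀`.
-/
theorem HasDivisibleType.exists_pi1Map_eq {T : SymCatGr.{u}} (hT : HasDivisibleType T)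
    {S : SymCatGr.{u}} (f₁ : Pi1 S →+ Pi1 T) : ∃ F : S ⟶ T, pi1Map F = f₁ := by
  choose f₀ hf₀ using fun x : Pi0 S => hT.exists_kInv_eq (f₁ (kInv S x))
    (by rw [← map_nsmul, two_nsmul_kInv, map_zero])
  obtain ⟨F, -, hF⟩ := exists_morphism (Or.inr hT.divisible)
    (AddMonoidHom.mk' f₀ fun x y => hT.injective (by simp only [hf₀, map_add])) f₁
    (AddMonoidHom.ext hf₀)
  exact ⟨F, hF⟩

theorem HasDivisibleType.isInjective {T : SymCatGr.{u}} (hT : HasDivisibleType T) :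
    T.IsInjective := by
  intro S₁ S₂ F hF G
  obtain ⟨f₁, hf₁⟩ := hT.divisible.exists_extension (pi1Map F) hF (pi1Map G)
  obtain ⟨L, hL⟩ := hT.exists_pi1Map_eq f₁
  have h₁ : pi1Map (F ≫ L) = pi1Map G := by rw [pi1Map_comp, hL, hf₁]
  refine ⟨L, nonempty_iso_of_pi_eq (Or.inr hT.divisible) ?_ h₁⟩
  ext x
  refine hT.injective ?_
  rw [kInv_naturality, kInv_naturality, h₁]

/-! ### Enough projective and injective objects -/

theorem exists_free_type (S : SymCatGr.{u}) : ∃ (P : Type u) (_ : AddCommGroup P),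
    Module.Free ℤ P ∧ (∃ T : SymCatGr.{u}, Nonempty (T.type ≅ GrType.l P)) ∧
      ∀ T : SymCatGr.{u}, Nonempty (T.type ≅ GrType.l P) →
        T.IsProjective ∧ ∃ F : T ⟶ S, IsEssSurj F := by
  refine ⟨Pi0 S →₀ ℤ, inferInstance, inferInstance, exists_type_iso_l _, ?_⟩
  rintro T ⟨e⟩
  have hT := hasFreeType_of_iso_l e
  refine ⟨hT.isProjective, ?_⟩
  obtain ⟨e₀, -, -⟩ := GrType.exists_equiv_of_iso e
  change Pi0 T ≃+ (Pi0 S →₀ ℤ) at e₀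
  obtain ⟨F, hF⟩ := hT.exists_pi0Map_eq
    ((Finsupp.liftAddHom fun x : Pi0 S => (zmultiplesHom (Pi0 S) x : ℤ →+ Pi0 S)).comp
      e₀.toAddMonoidHom)
  refine ⟨F, fun x => ⟨e₀.symm (Finsupp.single x 1), ?_⟩⟩
  rw [hF]
  simp

theorem exists_divisible_type (S : SymCatGr.{u}) : ∃ (Q : Type u) (_ : AddCommGroup Q),
    IsDivisible Q ∧ (∃ T : SymCatGr.{u}, Nonempty (T.type ≅ GrType.r Q)) ∧
      ∀ T : SymCatGr.{u}, Nonempty (T.type ≅ GrType.r Q) →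
        T.IsInjective ∧ ∃ F : S ⟶ T, IsFaithful F := by
  obtain ⟨Q, _, f, hQ, hf⟩ := IsDivisible.exists_embedding (Pi1 S)
  refine ⟨Q, inferInstance, hQ, exists_type_iso_r Q, ?_⟩
  rintro T ⟨e⟩
  have hT := hasDivisibleType_of_iso_r hQ e
  refine ⟨hT.isInjective, ?_⟩
  obtain ⟨-, e₁, -⟩ := GrType.exists_equiv_of_iso e
  change Pi1 T ≃+ Q at e₁
  obtain ⟨F, hF⟩ := hT.exists_pi1Map_eq (e₁.symm.toAddMonoidHom.comp f)
  refine ⟨F, ?_⟩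
  rw [IsFaithful, hF]
  exact e₁.symm.injective.comp hf

end SymCatGr

/-- The 2-category of symmetric categorical groups has enough projective and enough injective
objects. They can be taken to be the symmetric categorical groups of type `l(P)`, with `P` free
abelian, and of type `r(Q)`, with `Q` divisible; such symmetric categorical groups exist. -/
theorem proposition2 :
    -- enough projective objects
    (∀ S : SymCatGr.{u}, ∃ (P : SymCatGr.{u}) (F : P ⟶ S), P.IsProjective ∧ SymCatGr.IsEssSurj F) ∧
    -- enough injective objects
    (∀ S : SymCatGr.{u}, ∃ (Q : SymCatGr.{u}) (F : S ⟶ Q), Q.IsInjective ∧ SymCatGr.IsFaithful F) ∧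
    -- every `S` receives an essentially surjective morphism from the projective object `H(l(P))`
    (∀ S : SymCatGr.{u}, ∃ (P : Type u) (_ : AddCommGroup P), Module.Free ℤ P ∧
      (∃ T : SymCatGr.{u}, Nonempty (T.type ≅ GrType.l P)) ∧
      ∀ T : SymCatGr.{u}, Nonempty (T.type ≅ GrType.l P) →
        T.IsProjective ∧ ∃ F : T ⟶ S, SymCatGr.IsEssSurj F) ∧
    -- every `S` has a faithful morphism to the injective object `H(r(Q))`
    (∀ S : SymCatGr.{u}, ∃ (Q : Type u) (_ : AddCommGroup Q),
      (∀ n : ℕ, n ≠ 0 → ∀ q : Q, ∃ q' : Q, n • q' = q) ∧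
      (∃ T : SymCatGr.{u}, Nonempty (T.type ≅ GrType.r Q)) ∧
      ∀ T : SymCatGr.{u}, Nonempty (T.type ≅ GrType.r Q) →
        T.IsInjective ∧ ∃ F : S ⟶ T, SymCatGr.IsFaithful F) := by
  refine ⟨fun S => ?_, fun S => ?_, SymCatGr.exists_free_type, SymCatGr.exists_divisible_type⟩
  · obtain ⟨_, _, -, ⟨T, hT⟩, h⟩ := SymCatGr.exists_free_type S
    obtain ⟨hproj, F, hF⟩ := h T hT
    exact ⟨T, F, hproj, hF⟩
  · obtain ⟨_, _, -, ⟨T, hT⟩, h⟩ := SymCatGr.exists_divisible_type S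
    obtain ⟨hinj, F, hF⟩ := h T hT
    exact ⟨T, F, hinj, hF⟩
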